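/- Let $n \ge 2$ and let $K \subset \mathbb{R}^n$ be a convex body (a compact convex set with non-empty interior) whose boundary $\partial K$ is of class $C^3$ and has strictly positive Gauss curvature at every point. Write $|\cdot|$ for $n$-dimensional volume, $v_m$ for the volume of the Euclidean unit ball of $\mathbb{R}^m$ and, for $x \in K$, let $K^x = \{y \in \mathbb{R}^n : \langle y, z - x\rangle \le 1 \text{ for all } z \in K\}$ be the polar body of $K$ with respect to $x$. For $t \in \mathbb{R}$ let $$S(K,t) = \Big\{x \in K : \frac{|K|\,|K^x|}{v_n^2} \le t\Big\}$$ be the Santaló region of $K$ (with $|K^x| = \infty$ for $x \in \partial K$), and for $s > 0$ let the floating body $K_s$ be the set of all $x \in K$ such that $\langle x, u\rangle \le a$ for every unit vector $u$ and every $a \in \mathbb{R}$ with $|\{y \in K : \langle y, u\rangle \ge a\}| = s$. Then there is $\delta_0 > 0$ such that for all $\delta$ with $0 < \delta < \delta_0$ $$S\Big(K, \frac{v_{n-1}}{2(n+1)\,v_n\,\delta}\Big) \subseteq K_{\delta |K|}.$$ -/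

import Mathlib

open scoped Gradient Topology

namespace Santalo

/-- `v_n`, the volume of the Euclidean unit ball of `ℝⁿ` (so `v_0 = 1`). -/
noncomputable def ballVolume (n : ℕ) : ℝ :=
  MeasureTheory.volume.real (Metric.closedBall (0 : EuclideanSpace ℝ (Fin n)) 1)

/-- The polar body `K^x = (K - x)⁰ = {y : ⟨y, z - x⟩ ≤ 1 for all z ∈ K}`. -/
def polarAt {n : ℕ} (K : Set (EuclideanSpace ℝ (Fin n))) (x : EuclideanSpace ℝ (Fin n)) :
    Set (EuclideanSpace ℝ (Fin n)) :=
  {y | ∀ z ∈ K, inner ℝ y (z - x) ≤ 1}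

/-- The Santaló region `S(K, t) = {x ∈ K : |K| |K^x| / v_n² ≤ t}`.  The volumes are taken in
`[0, ∞]`, because `|K^x| = ∞` when `x` is a boundary point of `K`. -/
def santaloRegion {n : ℕ} (K : Set (EuclideanSpace ℝ (Fin n))) (t : ℝ) :
    Set (EuclideanSpace ℝ (Fin n)) :=
  {x | x ∈ K ∧ MeasureTheory.volume K * MeasureTheory.volume (polarAt K x) /
    ENNReal.ofReal (ballVolume n ^ 2) ≤ ENNReal.ofReal t}

/-- The (convex) floating body `K_s`: what remains of `K` in the intersection of all half-spaces
`{x : ⟨x, u⟩ ≤ a}`, `‖u‖ = 1`, whose bounding hyperplane cuts off from `K` a set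
`{y ∈ K : ⟨y, u⟩ ≥ a}` of volume `s`. -/
def floatingBody {n : ℕ} (K : Set (EuclideanSpace ℝ (Fin n))) (s : ℝ) :
    Set (EuclideanSpace ℝ (Fin n)) :=
  {x | x ∈ K ∧ ∀ (u : EuclideanSpace ℝ (Fin n)) (a : ℝ), ‖u‖ = 1 →
    MeasureTheory.volume {y | y ∈ K ∧ a ≤ inner ℝ y u} = ENNReal.ofReal s → inner ℝ x u ≤ a}

/-- `g` is a `C^k` defining function of `K` near the boundary point `x`: it is `C^k` around `x`,
vanishes at `x`, has nonzero gradient there, and `K = {g ≤ 0}` near `x`.  So `∂K = {g = 0}` near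
`x`, and `∇ g` points out of `K`. -/
structure IsDefiningFunction {n : ℕ} (k : ℕ) (K : Set (EuclideanSpace ℝ (Fin n)))
    (g : EuclideanSpace ℝ (Fin n) → ℝ) (x : EuclideanSpace ℝ (Fin n)) : Prop where
  contDiffAt : ContDiffAt ℝ k g x
  eq_zero : g x = 0
  gradient_ne_zero : ∇ g x ≠ 0
  mem_iff : ∀ᶠ y in 𝓝 x, (y ∈ K ↔ g y ≤ 0)

/-- The boundary of `K` is of class `C^k`. -/
def HasCkBoundary {n : ℕ} (k : ℕ) (K : Set (EuclideanSpace ℝ (Fin n))) : Prop :=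
  ∀ x ∈ frontier K, ∃ g, IsDefiningFunction k K g x

/-- The determinant of the compression `T → T`, `v ↦ P_T (A v)`, of `A` to the subspace `T`. -/
noncomputable def compressionDet {n : ℕ} (T : Submodule ℝ (EuclideanSpace ℝ (Fin n)))
    (A : EuclideanSpace ℝ (Fin n) →L[ℝ] EuclideanSpace ℝ (Fin n)) : ℝ :=
  LinearMap.det ((T.orthogonalProjectionOnto.toLinearMap ∘ₗ A.toLinearMap) ∘ₗ T.subtype)

/-- The Gauss curvature at `x` of the level hypersurface of `g` through `x`, with respect to the
unit normal field `N = ∇ g / ‖∇ g‖`.  It is the determinant of the Weingarten map `dN_x` of the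
tangent space `T = (∇ g x)^⊥`, that is of the self-adjoint map of `T` that represents the second
fundamental form `(v, w) ↦ D²g(x)(v, w) / ‖∇ g x‖` (the derivative of `1 / ‖∇ g‖` only contributes
normal components). -/
noncomputable def levelSetCurvature {n : ℕ} (g : EuclideanSpace ℝ (Fin n) → ℝ)
    (x : EuclideanSpace ℝ (Fin n)) : ℝ :=
  compressionDet (Submodule.span ℝ {∇ g x})ᗮ (‖∇ g x‖⁻¹ • fderiv ℝ (∇ g) x)

open Classical in
/-- The Gauss curvature of `∂K` at `x` (outer normal, so that it is positive for balls), computed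
from any `C²` defining function of `K` near `x`; it does not depend on which one is taken, see
`gaussCurvature_eq`.  The value is `0` if there is none. -/
noncomputable def gaussCurvature {n : ℕ} (K : Set (EuclideanSpace ℝ (Fin n)))
    (x : EuclideanSpace ℝ (Fin n)) : ℝ :=
  if h : ∃ g, IsDefiningFunction 2 K g x then levelSetCurvature h.choose x else 0

section WellDefined

variable {n : ℕ}

/-- First and second order behaviour of `g` along the parabola `x + t v - t² w`. -/
theorem deriv_parabola {g : EuclideanSpace ℝ (Fin n) → ℝ} {x : EuclideanSpace ℝ (Fin n)}
    (hg : ContDiffAt ℝ 2 g x) (v w : EuclideanSpace ℝ (Fin n)) :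
    deriv (fun t : ℝ => g (x + t • v - t ^ 2 • w)) 0 = inner ℝ (∇ g x) v ∧
    deriv (deriv (fun t : ℝ => g (x + t • v - t ^ 2 • w))) 0 =
      inner ℝ (fderiv ℝ (∇ g) x v) v - 2 * inner ℝ (∇ g x) w ∧
    ContinuousAt (fun t : ℝ => g (x + t • v - t ^ 2 • w)) 0 := by
  have hγ : ∀ t : ℝ, HasDerivAt (fun t : ℝ => x + t • v - t ^ 2 • w) (v - (2 * t) • w) t := by
    intro t
    have h1 := ((hasDerivAt_id t).smul_const v).const_add x
    have h2 := (hasDerivAt_pow 2 t).smul_const w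
    have h := h1.sub h2
    simp only [id_eq, one_smul, Nat.cast_ofNat, Nat.add_one_sub_one, pow_one] at h
    exact h
  have hγc : Filter.Tendsto (fun t : ℝ => x + t • v - t ^ 2 • w) (𝓝 0) (𝓝 x) := by
    simpa using (hγ 0).continuousAt.tendsto
  have hev : ∀ᶠ y in 𝓝 x, DifferentiableAt ℝ g y := by
    filter_upwards [hg.eventually (by simp)] with y hy
    exact hy.differentiableAt (by simp)
  have hd : ∀ᶠ t in 𝓝 (0 : ℝ), HasDerivAt (fun t : ℝ => g (x + t • v - t ^ 2 • w))
      (inner ℝ (∇ g (x + t • v - t ^ 2 • w)) (v - (2 * t) • w)) t := by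
    filter_upwards [hγc.eventually hev] with t ht
    have h := ht.hasGradientAt.hasFDerivAt.comp_hasDerivAt t (hγ t)
    simpa [Function.comp_def] using h
  have hgrad : DifferentiableAt ℝ (∇ g) x := by
    have h1 : DifferentiableAt ℝ (fderiv ℝ g) x :=
      (hg.fderiv_right (m := 1) (by norm_num)).differentiableAt (by simp)
    exact ((InnerProductSpace.toDual ℝ
      (EuclideanSpace ℝ (Fin n))).symm.toContinuousLinearEquiv.differentiableAt).comp x h1
  refine ⟨?_, ?_, ?_⟩
  · simpa using hd.self_of_nhds.deriv
  · have he : deriv (fun t : ℝ => g (x + t • v - t ^ 2 • w)) =ᶠ[𝓝 0]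
        fun t => inner ℝ (∇ g (x + t • v - t ^ 2 • w)) (v - (2 * t) • w) := by
      filter_upwards [hd] with t ht using ht.deriv
    rw [he.deriv_eq]
    have hG : HasDerivAt (fun t : ℝ => ∇ g (x + t • v - t ^ 2 • w)) (fderiv ℝ (∇ g) x v) 0 := by
      have h0 : HasFDerivAt (∇ g) (fderiv ℝ (∇ g) x)
          ((fun t : ℝ => x + t • v - t ^ 2 • w) 0) := by
        simpa using hgrad.hasFDerivAt
      have h := h0.comp_hasDerivAt (0 : ℝ) (hγ 0)
      simpa [Function.comp_def] using h
    have hL : HasDerivAt (fun t : ℝ => v - (2 * t) • w) (-((2 : ℝ) • w)) 0 := by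
      have h := (((hasDerivAt_id (0 : ℝ)).const_mul 2).smul_const w).const_sub v
      simpa using h
    have h := (hG.inner ℝ hL).deriv
    rw [h]
    simp [inner_neg_right, inner_smul_right]
    ring
  · exact hd.self_of_nhds.continuousAt

theorem IsDefiningFunction.gradient_parallel {K : Set (EuclideanSpace ℝ (Fin n))}
    {g₁ g₂ : EuclideanSpace ℝ (Fin n) → ℝ} {x : EuclideanSpace ℝ (Fin n)}
    (h₁ : IsDefiningFunction 2 K g₁ x) (h₂ : IsDefiningFunction 2 K g₂ x) :
    ∃ c : ℝ, 0 < c ∧ ∇ g₂ x = c • ∇ g₁ x := by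
  have key : ∀ v, inner ℝ (∇ g₁ x) v < 0 → inner ℝ (∇ g₂ x) v ≤ 0 := by
    intro v hv
    by_contra! hv2
    obtain ⟨d1, -, c1⟩ := deriv_parabola (by exact_mod_cast h₁.contDiffAt) v 0
    obtain ⟨d2, -, -⟩ := deriv_parabola (by exact_mod_cast h₂.contDiffAt) v 0
    simp only [smul_zero, sub_zero] at d1 d2 c1
    have e1 := eventually_nhdsWithin_sign_eq_of_deriv_neg (f := fun t : ℝ => g₁ (x + t • v))
      (x₀ := 0) (by rw [d1]; exact hv) (by simpa using h₁.eq_zero)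
    have e2 := eventually_nhdsWithin_sign_eq_of_deriv_pos (f := fun t : ℝ => g₂ (x + t • v))
      (x₀ := 0) (by rw [d2]; exact hv2) (by simpa using h₂.eq_zero)
    have ht : Filter.Tendsto (fun t : ℝ => x + t • v) (𝓝 0) (𝓝 x) := by
      have : ContinuousAt (fun t : ℝ => x + t • v) 0 := by fun_prop
      simpa using this.tendsto
    have e := ((e1.and e2).and (ht.eventually (h₁.mem_iff.and h₂.mem_iff))).filter_mono
      (nhdsWithin_le_nhds (s := Set.Ioi 0))
    obtain ⟨t, ⟨⟨s1, s2⟩, m1, m2⟩, htpos⟩ := (e.and self_mem_nhdsWithin).exists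
    have htpos : (0 : ℝ) < t := htpos
    have a1 : g₁ (x + t • v) < 0 := by
      rw [zero_sub, sign_neg (neg_lt_zero.mpr htpos)] at s1
      exact sign_eq_neg_one_iff.mp s1
    have a2 : 0 < g₂ (x + t • v) := by
      rw [sub_zero, sign_pos htpos] at s2
      exact sign_eq_one_iff.mp s2
    exact absurd (m2.mp (m1.mpr a1.le)) (not_le.mpr a2)
  have ha := h₁.gradient_ne_zero
  have hb := h₂.gradient_ne_zero
  generalize ∇ g₁ x = a at *
  generalize ∇ g₂ x = b at *
  have hapos : 0 < inner ℝ a a := real_inner_self_pos.mpr ha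
  set c : ℝ := inner ℝ a b / inner ℝ a a with hc
  set b' := b - c • a with hb'
  have hab' : inner ℝ a b' = 0 := by
    rw [hb', inner_sub_right, inner_smul_right, hc]; field_simp; simp
  have hbb' : inner ℝ b b' = inner ℝ b' b' := by
    have : b = b' + c • a := by rw [hb']; abel
    nth_rewrite 1 [this]
    rw [inner_add_left, inner_smul_left, hab']; simp
  have hb'0 : inner ℝ b' b' ≤ 0 := by
    by_contra! hpos
    set ε : ℝ := inner ℝ b' b' / (2 * (|inner ℝ b a| + 1)) with hε
    have hεpos : 0 < ε := by positivity
    have h := key (b' - ε • a) (by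
      rw [inner_sub_right, inner_smul_right, hab']; nlinarith)
    rw [inner_sub_right, inner_smul_right, hbb'] at h
    have h2 : ε * (2 * (|inner ℝ b a| + 1)) = inner ℝ b' b' := by rw [hε]; field_simp
    have h3 := le_abs_self (inner ℝ b a)
    have h4 := abs_nonneg (inner ℝ b a)
    nlinarith
  have hbz : b' = 0 := by
    by_contra hne
    exact absurd (real_inner_self_pos.mpr hne) (not_lt.mpr hb'0)
  have hbc : b = c • a := by rw [hb', sub_eq_zero] at hbz; exact hbz
  refine ⟨c, ?_, hbc⟩
  have hc0 : c ≠ 0 := by rintro h; apply hb; rw [hbc, h, zero_smul]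
  have h := key (-a) (by rw [inner_neg_right]; linarith)
  rw [hbc, inner_neg_right, inner_smul_left] at h
  simp only [conj_trivial] at h
  have : 0 ≤ c := by
    by_contra! hneg
    nlinarith
  exact lt_of_le_of_ne this hc0.symm

theorem IsDefiningFunction.second_le {K : Set (EuclideanSpace ℝ (Fin n))}
    {g₁ g₂ : EuclideanSpace ℝ (Fin n) → ℝ} {x : EuclideanSpace ℝ (Fin n)}
    (h₁ : IsDefiningFunction 2 K g₁ x) (h₂ : IsDefiningFunction 2 K g₂ x)
    {v : EuclideanSpace ℝ (Fin n)} (hv : inner ℝ (∇ g₁ x) v = 0) :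
    ‖∇ g₂ x‖⁻¹ * inner ℝ (fderiv ℝ (∇ g₂) x v) v ≤
      ‖∇ g₁ x‖⁻¹ * inner ℝ (fderiv ℝ (∇ g₁) x v) v := by
  by_contra! hlt
  obtain ⟨c, hc, hpar⟩ := h₁.gradient_parallel h₂
  have n1 : 0 < ‖∇ g₁ x‖ := norm_pos_iff.mpr h₁.gradient_ne_zero
  have n2 : ‖∇ g₂ x‖ = c * ‖∇ g₁ x‖ := by rw [hpar, norm_smul, Real.norm_of_nonneg hc.le]
  have n2' : 0 < ‖∇ g₂ x‖ := by rw [n2]; positivity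
  obtain ⟨m, hm1, hm2⟩ := exists_between hlt
  set w := (m / 2 * ‖∇ g₁ x‖⁻¹) • ∇ g₁ x with hw
  have w1 : 2 * inner ℝ (∇ g₁ x) w = m * ‖∇ g₁ x‖ := by
    rw [hw, inner_smul_right, real_inner_self_eq_norm_sq]; field_simp
  have w2 : 2 * inner ℝ (∇ g₂ x) w = m * ‖∇ g₂ x‖ := by
    rw [n2, hpar, inner_smul_left, conj_trivial, mul_left_comm, w1]; ring
  obtain ⟨d1, s1, c1⟩ := deriv_parabola (by exact_mod_cast h₁.contDiffAt) v w
  obtain ⟨d2, s2, c2⟩ := deriv_parabola (by exact_mod_cast h₂.contDiffAt) v w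
  rw [hv] at d1
  rw [hpar, inner_smul_left, hv, mul_zero] at d2
  have L1 := isLocalMax_of_deriv_deriv_neg (by
    rw [s1, w1, sub_neg]
    rwa [inv_mul_lt_iff₀ n1, mul_comm] at hm1) d1 c1
  have P2 : 0 < deriv (deriv (fun t : ℝ => g₂ (x + t • v - t ^ 2 • w))) 0 := by
    rw [s2, w2, sub_pos]
    rwa [lt_inv_mul_iff₀ n2', mul_comm] at hm2
  have L2 := isLocalMin_of_deriv_deriv_pos P2 d2 c2
  have ht : Filter.Tendsto (fun t : ℝ => x + t • v - t ^ 2 • w) (𝓝 0) (𝓝 x) := by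
    have : ContinuousAt (fun t : ℝ => x + t • v - t ^ 2 • w) 0 := by fun_prop
    simpa using this.tendsto
  have hz : (fun t : ℝ => g₂ (x + t • v - t ^ 2 • w)) =ᶠ[𝓝 0] fun _ => (0 : ℝ) := by
    filter_upwards [L1, L2, ht.eventually (h₁.mem_iff.and h₂.mem_iff)] with t a1 a2 m12
    simp only [zero_smul, add_zero, ne_eq, OfNat.ofNat_ne_zero, not_false_eq_true, zero_pow,
      sub_zero, h₁.eq_zero, h₂.eq_zero] at a1 a2
    exact le_antisymm (m12.2.mp (m12.1.mpr a1)) a2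
  have := hz.deriv.deriv_eq
  simp [this] at P2

theorem fderiv_gradient_symm {g : EuclideanSpace ℝ (Fin n) → ℝ} {x : EuclideanSpace ℝ (Fin n)}
    (hg : ContDiffAt ℝ 2 g x) (v w : EuclideanSpace ℝ (Fin n)) :
    inner ℝ (fderiv ℝ (∇ g) x v) w = inner ℝ (fderiv ℝ (∇ g) x w) v := by
  have h1 : DifferentiableAt ℝ (fderiv ℝ g) x :=
    (hg.fderiv_right (m := 1) (by norm_num)).differentiableAt (by simp)
  have h2 : ∀ v w, inner ℝ (fderiv ℝ (∇ g) x v) w = fderiv ℝ (fderiv ℝ g) x v w := by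
    intro v w
    have h3 : HasFDerivAt (∇ g) _ x := ((InnerProductSpace.toDual ℝ
      (EuclideanSpace ℝ (Fin n))).symm.toContinuousLinearEquiv.hasFDerivAt).comp x h1.hasFDerivAt
    rw [h3.fderiv]
    simp
  rw [h2, h2]
  exact (hg.isSymmSndFDerivAt (by simp)) v w

/-- The Gauss curvature of `∂K` can be computed from every `C²` defining function. -/
theorem gaussCurvature_eq {K : Set (EuclideanSpace ℝ (Fin n))}
    {g : EuclideanSpace ℝ (Fin n) → ℝ} {x : EuclideanSpace ℝ (Fin n)}
    (hg : IsDefiningFunction 2 K g x) : gaussCurvature K x = levelSetCurvature g x := by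
  have hex : ∃ g, IsDefiningFunction 2 K g x := ⟨g, hg⟩
  rw [gaussCurvature, dif_pos hex]
  have hf := hex.choose_spec
  generalize hex.choose = f at hf
  obtain ⟨c, hc, hpar⟩ := hg.gradient_parallel hf
  have hT : (Submodule.span ℝ {∇ f x})ᗮ = (Submodule.span ℝ {∇ g x})ᗮ := by
    rw [hpar, Submodule.span_singleton_smul_eq (IsUnit.mk0 c hc.ne')]
  unfold levelSetCurvature
  rw [hT]
  set A := ‖∇ f x‖⁻¹ • fderiv ℝ (∇ f) x with hA
  set B := ‖∇ g x‖⁻¹ • fderiv ℝ (∇ g) x with hB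
  have hq : ∀ v, inner ℝ (∇ g x) v = 0 → inner ℝ (A v) v = inner ℝ (B v) v := by
    intro v hv
    have hv' : inner ℝ (∇ f x) v = 0 := by rw [hpar, inner_smul_left, hv, mul_zero]
    simpa [hA, hB, inner_smul_left] using
      le_antisymm (hg.second_le hf hv) (hf.second_le hg hv')
  have sA : ∀ v w, inner ℝ (A v) w = inner ℝ (A w) v := by
    intro v w
    simp [hA, inner_smul_left, fderiv_gradient_symm (by exact_mod_cast hf.contDiffAt) v w]
  have sB : ∀ v w, inner ℝ (B v) w = inner ℝ (B w) v := by
    intro v w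
    simp [hB, inner_smul_left, fderiv_gradient_symm (by exact_mod_cast hg.contDiffAt) v w]
  have hpol : ∀ v w, inner ℝ (∇ g x) v = 0 → inner ℝ (∇ g x) w = 0 →
      inner ℝ (A v) w = inner ℝ (B v) w := by
    intro v w hv hw
    have h := hq (v + w) (by rw [inner_add_right, hv, hw, add_zero])
    simp only [map_add, inner_add_left, inner_add_right] at h
    have := hq v hv
    have := hq w hw
    have := sA v w
    have := sB v w
    linarith
  unfold compressionDet
  congr 1
  ext1 v
  have hmem : ∀ u : EuclideanSpace ℝ (Fin n), u ∈ (Submodule.span ℝ {∇ g x})ᗮ →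
      inner ℝ (∇ g x) u = 0 := fun u hu => Submodule.mem_orthogonal_singleton_iff_inner_right.mp hu
  apply ext_inner_right ℝ
  intro w
  have := hpol v w (hmem _ v.2) (hmem _ w.2)
  simpa using this

end WellDefined

end Santalo

open MeasureTheory Module

namespace Santalo

/-! Let `x ∈ K` lie outside the floating body. Then `x` lies strictly beyond the hyperplane that
cuts off some cap `C` of `K` with `|C| = δ|K|`. Membership in the Santaló region bounds `|K^x| |C|`
above by `v_{n-1} v_n / (2(n+1))`, so it suffices to show that this product is larger for all caps
of small height.

The model is the paraboloid `|w|² ≤ 2Rt`. Its cap of height `h` has volume `v_{n-1} (2Rh)^{(n-1)/2}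
h · 2/(n+1)`. Its polar body at the axis point of height `h` is an ellipsoid with one semi-axis
`1/(2h)` and the others `1/√(2Rh)`. The product of the two volumes is `v_{n-1} v_n / (n+1)`,
whatever `h` and `R` are. This is twice what is needed, and the factor 2 pays for every
approximation. Points off the axis cost nothing: a volume preserving shear of the ellipsoid handles
them.

For `K` itself, `le_volume_cap` uses a tangent ball of radius `r` inside, `le_volume_polarAt` one of
radius `R` outside. Both are local at the tip of the cap, and convexity controls the rest of `K`.
The ratio `r/R` must be near 1, while the boundary may have different principal curvatures. Since
`|K^x| |C|` is invariant under linear maps, the square root of a positive definite second derivative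
may be applied first (`lt_volume_polarAt_mul_volume_cap_of_linear`). Positive curvature supplies
such a defining function, and a Taylor expansion makes the estimate uniform near each boundary point
(`exists_nhds_lt_volume_mul`). Compactness then gives one admissible height, and
`exists_le_volume_cap` shows that caps of small volume stay below it. -/

/-! ### Volumes in split coordinates -/

/-- Orthogonal splitting of `ℝ^{m+1}` along a unit vector, as a measure preserving map. -/
theorem exists_measurePreserving_split {m : ℕ} {u : EuclideanSpace ℝ (Fin (m + 1))}
    (hu : ‖u‖ = 1) :
    ∃ Φ : (ℝ × EuclideanSpace ℝ (Fin m)) ≃ₗ[ℝ] EuclideanSpace ℝ (Fin (m + 1)),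
      MeasurePreserving Φ volume volume ∧
      (∀ a b, inner ℝ (Φ a) (Φ b) = a.1 * b.1 + inner ℝ a.2 b.2) ∧ Φ (1, 0) = u := by
  obtain ⟨b, hb⟩ := Orthonormal.exists_orthonormalBasis_extension_of_card_eq
    (𝕜 := ℝ) (E := EuclideanSpace ℝ (Fin (m + 1))) (ι := Fin (m + 1)) (by simp)
    (v := fun _ => u) (s := {0}) (by
      constructor
      · intro i; simpa using hu
      · intro i j hij; exact absurd (Subsingleton.elim i j) hij)
  have hb0 : b 0 = u := hb 0 rfl
  let Φ : (ℝ × EuclideanSpace ℝ (Fin m)) ≃ₗ[ℝ] EuclideanSpace ℝ (Fin (m + 1)) :=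
    (((LinearEquiv.refl ℝ ℝ).prodCongr (WithLp.linearEquiv 2 ℝ (Fin m → ℝ))).trans
      (Fin.consLinearEquiv ℝ (fun _ : Fin (m + 1) => ℝ))).trans
      ((WithLp.linearEquiv 2 ℝ (Fin (m + 1) → ℝ)).symm.trans b.repr.symm.toLinearEquiv)
  have hΦ : ∀ a, Φ a = b.repr.symm (WithLp.toLp 2 (Fin.cons a.1 a.2.ofLp)) := fun a => rfl
  refine ⟨Φ, ?_, ?_, ?_⟩
  · have h1 : MeasurePreserving (fun a : ℝ × EuclideanSpace ℝ (Fin m) => (a.1, a.2.ofLp))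
        volume volume :=
      (MeasurePreserving.id (volume : Measure ℝ)).prod (PiLp.volume_preserving_ofLp (Fin m))
    have h2 := (volume_preserving_piFinSuccAbove (fun _ : Fin (m + 1) => ℝ) 0).symm
    have h3 := b.measurePreserving_repr_symm.comp
      ((PiLp.volume_preserving_toLp (Fin (m + 1))).comp (h2.comp h1))
    convert! h3 using 1
    ext1 a
    simp [hΦ, MeasurableEquiv.piFinSuccAbove, Fin.insertNthEquiv]
  · intro a c
    rw [hΦ, hΦ, LinearIsometryEquiv.inner_map_map]
    simp [PiLp.inner_apply, Fin.sum_univ_succ]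
    ring
  · rw [hΦ, ← hb0]
    apply b.repr.injective
    ext i
    refine Fin.cases ?_ (fun j => ?_) i <;> simp

theorem ballVolume_pos (n : ℕ) : 0 < ballVolume n := by
  unfold ballVolume
  rw [Measure.real, ENNReal.toReal_pos_iff]
  exact ⟨Metric.measure_closedBall_pos _ _ one_pos, measure_closedBall_lt_top⟩

theorem ofReal_ballVolume (n : ℕ) : ENNReal.ofReal (ballVolume n) =
    volume (Metric.closedBall (0 : EuclideanSpace ℝ (Fin n)) 1) :=
  ENNReal.ofReal_toReal measure_closedBall_lt_top.ne

theorem volume_closedBall_eq {m : ℕ} (x : EuclideanSpace ℝ (Fin m)) {r : ℝ} (hr : 0 ≤ r) :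
    volume (Metric.closedBall x r) = ENNReal.ofReal (r ^ m * ballVolume m) := by
  rw [Measure.addHaar_closedBall' _ _ hr, ENNReal.ofReal_mul (by positivity), ofReal_ballVolume]
  simp

/-- Volume of a paraboloid cap. -/
theorem volume_paraboloid {m : ℕ} {c h : ℝ} (hc : 0 ≤ c) (hh : 0 ≤ h) :
    volume {a : ℝ × EuclideanSpace ℝ (Fin m) | 0 ≤ a.1 ∧ ‖a.2‖ ^ 2 ≤ c * a.1 ∧ a.1 ≤ h} =
      ENNReal.ofReal (ballVolume m * (√(c * h) ^ m * h * (2 / (m + 2)))) := by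
  have hmeas : MeasurableSet
      {a : ℝ × EuclideanSpace ℝ (Fin m) | 0 ≤ a.1 ∧ ‖a.2‖ ^ 2 ≤ c * a.1 ∧ a.1 ≤ h} := by
    refine IsClosed.measurableSet ?_
    simp only [Set.ofPred_and]
    refine IsClosed.inter ?_ (IsClosed.inter ?_ ?_) <;>
      exact isClosed_le (by fun_prop) (by fun_prop)
  have hslice : ∀ t : ℝ, volume (Prod.mk t ⁻¹'
      {a : ℝ × EuclideanSpace ℝ (Fin m) | 0 ≤ a.1 ∧ ‖a.2‖ ^ 2 ≤ c * a.1 ∧ a.1 ≤ h}) =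
      (Set.Icc 0 h).indicator (fun t => ENNReal.ofReal (√(c * t) ^ m * ballVolume m)) t := by
    intro t
    by_cases ht : t ∈ Set.Icc 0 h
    · rw [Set.indicator_of_mem ht, ← volume_closedBall_eq 0 (Real.sqrt_nonneg _)]
      congr 1
      ext w
      simp only [Set.mem_preimage, Set.mem_ofPred_eq, mem_closedBall_zero_iff, ht.1, ht.2,
        true_and, and_true]
      rw [Real.le_sqrt (norm_nonneg _) (mul_nonneg hc ht.1)]
    · rw [Set.indicator_of_notMem ht]
      convert measure_empty (μ := (volume : Measure (EuclideanSpace ℝ (Fin m))))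
      ext w
      simp only [Set.mem_preimage, Set.mem_ofPred_eq, Set.mem_empty_iff_false, iff_false]
      rintro ⟨h1, -, h2⟩
      exact ht ⟨h1, h2⟩
  rw [Measure.volume_eq_prod, Measure.prod_apply hmeas]
  simp_rw [hslice]
  rw [lintegral_indicator measurableSet_Icc, ← ofReal_integral_eq_lintegral_ofReal]
  · congr 1
    rw [integral_mul_const, integral_Icc_eq_integral_Ioc,
      ← intervalIntegral.integral_of_le hh]
    have h1 : ∀ t ∈ Set.uIcc 0 h, √(c * t) ^ m = √c ^ m * t ^ ((m : ℝ) / 2) := by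
      intro t ht
      rw [Set.uIcc_of_le hh] at ht
      rw [Real.sqrt_mul hc, mul_pow, Real.sqrt_eq_rpow t, ← Real.rpow_natCast (t ^ (1 / 2 : ℝ)),
        ← Real.rpow_mul ht.1]
      congr 2
      ring
    have hm : (0 : ℝ) ≤ m / 2 := by positivity
    rw [intervalIntegral.integral_congr h1, intervalIntegral.integral_const_mul,
      integral_rpow (Or.inl (by linarith)), h1 h (by simp), Real.zero_rpow (by linarith)]
    rcases hh.eq_or_lt with rfl | hpos
    · rw [Real.zero_rpow (by linarith)]; simp
    · rw [Real.rpow_add_one hpos.ne']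
      field_simp
      ring
  · apply ContinuousOn.integrableOn_Icc
    fun_prop
  · exact Filter.Eventually.of_forall fun t => by
      have := ballVolume_pos m
      positivity

theorem volume_image_prod_smul {m : ℕ} {a b : ℝ} (ha : 0 ≤ a) (hb : 0 ≤ b)
    (S : Set (ℝ × EuclideanSpace ℝ (Fin m))) :
    volume ((fun z : ℝ × EuclideanSpace ℝ (Fin m) => (a * z.1, b • z.2)) '' S) =
      ENNReal.ofReal (a * b ^ m) * volume S := by
  let M : (ℝ × EuclideanSpace ℝ (Fin m)) →ₗ[ℝ] (ℝ × EuclideanSpace ℝ (Fin m)) :=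
    LinearMap.prodMap (a • LinearMap.id) (b • LinearMap.id)
  have : (volume : Measure (ℝ × EuclideanSpace ℝ (Fin m))).IsAddHaarMeasure := by
    rw [Measure.volume_eq_prod]; infer_instance
  have h := Measure.addHaar_image_linearMap (volume : Measure (ℝ × EuclideanSpace ℝ (Fin m))) M S
  have hd : LinearMap.det M = a * b ^ m := by
    simp [M, LinearMap.det_prodMap, LinearMap.det_smul]
  rw [hd, abs_of_nonneg (by positivity)] at h
  exact h

/-- This inequality holds for arbitrary sets, so polar bodies and caps can be bounded below without
proving them measurable. -/
theorem le_volume_of_measurePreserving {α β : Type*} [MeasurableSpace α] [MeasurableSpace β]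
    {μ : Measure α} {ν : Measure β} {f : α → β} (hf : MeasurePreserving f μ ν) (s : Set β) :
    μ (f ⁻¹' s) ≤ ν s := by
  conv_rhs => rw [← hf.map_eq]
  exact Measure.le_map_apply hf.aemeasurable s

/-! ### Caps and polar bodies compared with tangent balls -/

/-- If `K` contains near `p` the ball of radius `r` tangent at `p` to the hyperplane orthogonal
to `u`, the cap of height `h` of `K` at `p` is at least as large as a paraboloid cap. -/
theorem le_volume_cap {m : ℕ} {K : Set (EuclideanSpace ℝ (Fin (m + 1)))}
    {p u : EuclideanSpace ℝ (Fin (m + 1))} (hu : ‖u‖ = 1) {r ρ h : ℝ} (hρ : 0 ≤ ρ) (hh : 0 ≤ h)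
    (hr : h ≤ 2 * r) (hrρ : 2 * r * h ≤ ρ ^ 2)
    (hin : ∀ z, ‖z - p‖ ≤ ρ → ‖z - p‖ ^ 2 ≤ 2 * r * inner ℝ (p - z) u → z ∈ K) :
    ENNReal.ofReal (ballVolume m * (√((2 * r - h) * h) ^ m * h * (2 / (m + 2)))) ≤
      volume {z | z ∈ K ∧ inner ℝ (p - z) u ≤ h} := by
  obtain ⟨Φ, hΦm, hΦ, hΦu⟩ := exists_measurePreserving_split hu
  rw [← volume_paraboloid (by linarith) hh]
  refine le_trans (measure_mono ?_) (le_volume_of_measurePreserving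
    ((Measure.measurePreserving_sub_left volume p).comp hΦm) _)
  rintro a ⟨ha0, ha1, ha2⟩
  have e1 : inner ℝ (p - (p - Φ a)) u = a.1 := by
    rw [sub_sub_cancel, ← hΦu, hΦ]; simp
  have e2 : ‖p - Φ a - p‖ ^ 2 = a.1 ^ 2 + ‖a.2‖ ^ 2 := by
    rw [sub_sub_cancel_left, norm_neg, ← real_inner_self_eq_norm_sq, hΦ,
      real_inner_self_eq_norm_sq]; ring
  -- As `a.1 ≤ h`, replacing `2r` by `2r - h` in the paraboloid leaves room for the term `a.1 ^ 2`
  -- of the ball.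
  have e3 : ‖p - Φ a - p‖ ^ 2 ≤ 2 * r * a.1 := by rw [e2]; nlinarith
  refine ⟨hin _ ?_ ?_, ?_⟩
  · refine abs_le_of_sq_le_sq' (e3.trans (le_trans ?_ hrρ)) hρ |>.2
    gcongr
    exact hh.trans hr
  · simpa only [Function.comp, e1] using e3
  · simpa only [Function.comp, e1] using ha2

/-- The polar inequality for a paraboloid in coordinates. -/
theorem polar_paraboloid {F : Type*} [NormedAddCommGroup F] [InnerProductSpace ℝ F]
    {R h s hx : ℝ} (hR : 0 < R) (hs : 0 < s) (hxh : hx ≤ h) {W ξ ζ : F} {t : ℝ}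
    (hW : R * ‖W‖ ^ 2 + 2 * h * s ^ 2 ≤ 2 * s)
    (hζ : ‖ζ‖ ^ 2 ≤ 2 * R * t ∨ 0 ≤ s * t + inner ℝ (W - (s / R) • ξ) ζ) :
    s * (hx - t) + inner ℝ (W - (s / R) • ξ) (ξ - ζ) ≤ 1 := by
  set y := W - (s / R) • ξ with hy
  have hy2 : R ^ 2 * ‖y‖ ^ 2 = R ^ 2 * ‖W‖ ^ 2 - 2 * R * s * inner ℝ W ξ + s ^ 2 * ‖ξ‖ ^ 2 := by
    rw [hy, norm_sub_sq_real, inner_smul_right, norm_smul, mul_pow, Real.norm_eq_abs, sq_abs]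
    field_simp
  have hyξ : R * inner ℝ y ξ = R * inner ℝ W ξ - s * ‖ξ‖ ^ 2 := by
    rw [hy, inner_sub_left, inner_smul_left, real_inner_self_eq_norm_sq]
    simp only [conj_trivial]
    field_simp
  -- Completing the square in `ξ` leaves `-(s²/R)‖ξ‖²`: moving off the axis after the shear only
  -- helps.
  have hkey : R * ‖y‖ ^ 2 + 2 * s * inner ℝ y ξ + 2 * s ^ 2 * h ≤ 2 * s := by
    have h3 : R * (R * ‖y‖ ^ 2 + 2 * s * inner ℝ y ξ) ≤ R * (R * ‖W‖ ^ 2) := by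
      have : 0 ≤ s ^ 2 * ‖ξ‖ ^ 2 := by positivity
      nlinarith
    have := le_of_mul_le_mul_left h3 hR
    linarith
  -- This is the support function of the paraboloid, maximal at `ζ = -(R/s) y`. In the second
  -- alternative the left side is already nonpositive.
  have hsup : 2 * s * (-(s * t) - inner ℝ y ζ) ≤ R * ‖y‖ ^ 2 := by
    rcases hζ with h1 | h1
    · have h2 : 0 ≤ ‖R • y + s • ζ‖ ^ 2 := by positivity
      rw [norm_add_sq_real, inner_smul_left, inner_smul_right, norm_smul, norm_smul, mul_pow,
        mul_pow, Real.norm_eq_abs, sq_abs, Real.norm_eq_abs, sq_abs] at h2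
      simp only [conj_trivial] at h2
      have h4 : s ^ 2 * ‖ζ‖ ^ 2 ≤ s ^ 2 * (2 * R * t) := by gcongr
      refine le_of_mul_le_mul_left (a := R) ?_ hR
      nlinarith
    · have h2 : 0 ≤ R * ‖y‖ ^ 2 := by positivity
      nlinarith
  rw [inner_sub_right]
  have hx' : s * hx ≤ s * h := by gcongr
  refine le_of_mul_le_mul_left (a := 2 * s) ?_ (by positivity)
  nlinarith

/-- A ball of radius `R` tangent to a hyperplane that contains a convex set near the point of
contact controls the whole convex set. -/
theorem _root_.Convex.sq_norm_sub_le_or {E : Type*} [NormedAddCommGroup E]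
    [InnerProductSpace ℝ E] {K : Set E} (hK : Convex ℝ K) {p u : E} (hp : p ∈ K) {R ρ : ℝ}
    (hρ : 0 < ρ)
    (hout : ∀ z ∈ K, ‖z - p‖ ≤ ρ → ‖z - p‖ ^ 2 ≤ 2 * R * inner ℝ (p - z) u) :
    ∀ z ∈ K, ‖z - p‖ ^ 2 ≤ 2 * R * inner ℝ (p - z) u ∨
      ‖z - p‖ * ρ ≤ 2 * R * inner ℝ (p - z) u := by
  intro z hz
  rcases le_or_gt ‖z - p‖ ρ with h1 | h1
  · exact Or.inl (hout z hz h1)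
  · right
    have hpos : 0 < ‖z - p‖ := hρ.trans h1
    -- Convexity puts the point of the segment at distance `ρ` from `p` in `K`. The quadratic bound
    -- there becomes a linear one at `z`.
    have hq : p + (ρ / ‖z - p‖) • (z - p) ∈ K :=
      hK.add_smul_sub_mem hp hz ⟨by positivity, (div_le_one hpos).2 h1.le⟩
    have hn : ‖p + (ρ / ‖z - p‖) • (z - p) - p‖ = ρ := by
      rw [add_sub_cancel_left, norm_smul, Real.norm_of_nonneg (by positivity)]
      field_simp
    have h2 := hout _ hq hn.le
    rw [hn, sub_add_cancel_left, ← smul_neg, neg_sub, inner_smul_left] at h2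
    simp only [conj_trivial] at h2
    have h3 : 2 * R * (ρ / ‖z - p‖ * inner ℝ (p - z) u) =
      ρ * (2 * R * inner ℝ (p - z) u) / ‖z - p‖ := by ring
    rw [h3, le_div_iff₀ hpos] at h2
    nlinarith

/-- For points of `K` far from `p` the height grows linearly with the distance, so the polar
inequality survives if the tangential part of the polar vector is small against `s`. Shrinking the
ellipsoid by `l` keeps `s` away from `0`. The translation part and the shear part each use half of
`ρ * s`, and each requires the constant 32 in `hhρ`. -/
theorem norm_shear_le {F : Type*} [NormedAddCommGroup F] [NormedSpace ℝ F]
    {R h s ρ l : ℝ} (hR : 0 < R) (hh : 0 < h) (hs : 0 < s) (hρ : 0 ≤ ρ) (hl0 : 0 < l) (hl : l < 1)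
    (hsl : 1 / (2 * h) * (1 - l) ≤ s) (hhρ : 32 * R * h ≤ (1 - l) ^ 2 * ρ ^ 2)
    (hl2 : (1 - l) ^ 2 * ρ ^ 2 ≤ ρ ^ 2) {w ξ : F} (hw : ‖w‖ ≤ 1) (hξ : ‖ξ‖ ^ 2 ≤ 2 * R * h) :
    2 * R * ‖(1 / √(2 * h * R) * l) • w - (s / R) • ξ‖ ≤ ρ * s := by
  set α : ℝ := 1 / √(2 * h * R) with hα
  have hαpos : 0 < α := by positivity
  have hα2 : R * α ^ 2 = 1 / (2 * h) := by
    rw [hα, div_pow, Real.sq_sqrt (by positivity)]; field_simp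
  have e1 : ‖(α * l) • w - (s / R) • ξ‖ ≤ α + s / R * ‖ξ‖ := by
    refine (norm_sub_le _ _).trans ?_
    rw [norm_smul, norm_smul, Real.norm_of_nonneg (by positivity),
      Real.norm_of_nonneg (by positivity)]
    gcongr
    rw [mul_assoc]
    exact mul_le_of_le_one_right hαpos.le (mul_le_one₀ hl.le (norm_nonneg _) hw)
  have e2 : 4 * ‖ξ‖ ≤ ρ := by
    refine abs_le_of_sq_le_sq' ?_ hρ |>.2
    nlinarith
  have e3 : 4 * (R * α) ≤ ρ * (1 / (2 * h) * (1 - l)) := by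
    refine abs_le_of_sq_le_sq' ?_
      (mul_nonneg hρ (mul_nonneg (by positivity) (by linarith))) |>.2
    have h4 : (4 * (R * α)) ^ 2 = 16 * R * (1 / (2 * h)) := by rw [← hα2]; ring
    have h5 : (ρ * (1 / (2 * h) * (1 - l))) ^ 2 = ((1 - l) ^ 2 * ρ ^ 2) / (4 * h ^ 2) := by
      field_simp; ring
    have h6 : 16 * R * (1 / (2 * h)) * (4 * h ^ 2) = 32 * R * h := by field_simp; ring
    rw [h4, h5, le_div_iff₀ (by positivity), h6]
    exact hhρ
  have e4 : 2 * R * (s / R * ‖ξ‖) = s * (2 * ‖ξ‖) := by field_simp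
  calc 2 * R * ‖(α * l) • w - (s / R) • ξ‖ ≤ 2 * R * (α + s / R * ‖ξ‖) := by gcongr
    _ = 2 * (R * α) + s * (2 * ‖ξ‖) := by rw [mul_add, e4]; ring
    _ ≤ ρ * s := by nlinarith

set_option maxHeartbeats 1000000 in
/-- If the convex set `K` lies near `p` in the ball of radius `R` tangent at `p` to the
hyperplane orthogonal to `u`, the polar body of `K` at a point at distance at most `h` from this
hyperplane is at least as large as a slightly shrunk ellipsoid. -/
theorem le_volume_polarAt {m : ℕ} {K : Set (EuclideanSpace ℝ (Fin (m + 1)))} (hK : Convex ℝ K)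
    {p u x : EuclideanSpace ℝ (Fin (m + 1))} (hu : ‖u‖ = 1) (hp : p ∈ K) (hx : x ∈ K)
    {R ρ h l : ℝ} (hρ : 0 < ρ) (hR : 0 < R) (hh : 0 < h) (hxh : inner ℝ (p - x) u ≤ h)
    (hl0 : 0 < l) (hl : l < 1) (hhρ : 32 * R * h ≤ (1 - l) ^ 2 * ρ ^ 2)
    (hout : ∀ z ∈ K, ‖z - p‖ ≤ ρ → ‖z - p‖ ^ 2 ≤ 2 * R * inner ℝ (p - z) u) :
    ENNReal.ofReal (l ^ (m + 1) * (1 / (2 * h)) * (1 / √(2 * h * R)) ^ m * ballVolume (m + 1)) ≤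
      volume (polarAt K x) := by
  obtain ⟨Φ, hΦm, hΦ, hΦu⟩ := exists_measurePreserving_split hu
  -- points of `K` in coordinates
  have hfar := hK.sq_norm_sub_le_or hp hρ hout
  have hl2 : (1 - l) ^ 2 * ρ ^ 2 ≤ ρ ^ 2 :=
    mul_le_of_le_one_left (by positivity) (pow_le_one₀ (by linarith) (by linarith))
  have hcoord : ∀ z, ∃ a : ℝ × EuclideanSpace ℝ (Fin m), p - z = Φ a ∧
      inner ℝ (p - z) u = a.1 ∧ ‖z - p‖ ^ 2 = a.1 ^ 2 + ‖a.2‖ ^ 2 := by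
    intro z
    obtain ⟨a, ha⟩ := Φ.surjective (p - z)
    refine ⟨a, ha.symm, ?_, ?_⟩
    · rw [← ha, ← hΦu, hΦ]; simp
    · rw [← norm_neg, neg_sub, ← ha, ← real_inner_self_eq_norm_sq, hΦ,
        real_inner_self_eq_norm_sq]; ring
  obtain ⟨ξ, hξ1, hξ2, hξ3⟩ := hcoord x
  set b : ℝ := 1 / (2 * h) with hb
  set α : ℝ := 1 / √(2 * h * R) with hα
  have hbpos : 0 < b := by positivity
  have hαpos : 0 < α := by positivity
  have hα2 : R * α ^ 2 = 1 / (2 * h) := by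
    rw [hα, div_pow, Real.sq_sqrt (by positivity)]; field_simp
  -- `‖ξ.2‖` is small
  have hξn : ‖ξ.2‖ ^ 2 ≤ 2 * R * h := by
    rw [hξ2] at hxh
    rcases hfar x hx with h1 | h1
    · rw [hξ3, hξ2] at h1
      nlinarith
    · rw [hξ2] at h1
      have h0 : 0 ≤ ξ.1 := by
        have : 0 ≤ 2 * R * ξ.1 := le_trans (by positivity) h1
        exact nonneg_of_mul_nonneg_right this (by positivity)
      have h2 : ‖x - p‖ ^ 2 * ρ ^ 2 ≤ 4 * R ^ 2 * h ^ 2 := by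
        calc ‖x - p‖ ^ 2 * ρ ^ 2 = (‖x - p‖ * ρ) ^ 2 := by ring
          _ ≤ (2 * R * h) ^ 2 := by
            refine pow_le_pow_left₀ (by positivity) (h1.trans ?_) 2
            gcongr
          _ = _ := by ring
      have h3 : 2 * R * h ≤ ρ ^ 2 := by linarith [mul_pos hR hh]
      have h4 : ‖x - p‖ ^ 2 * ρ ^ 2 ≤ 2 * R * h * ρ ^ 2 :=
        h2.trans (by nlinarith [mul_pos hR hh])
      have h5 := le_of_mul_le_mul_right h4 (by positivity)
      nlinarith
  -- The map moves the centre of the ellipsoid to height `b` and shears by the offset of `x` from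
  -- the axis.
  let σ : ℝ × EuclideanSpace ℝ (Fin m) → ℝ × EuclideanSpace ℝ (Fin m) :=
    fun a => (a.1 + b, a.2 + (-((a.1 + b) / R)) • ξ.2)
  have hσ : MeasurePreserving σ volume volume := by
    refine MeasurePreserving.skew_product (g := fun a w => w + (-((a + b) / R)) • ξ.2)
      (measurePreserving_add_right volume b) ?_ ?_
    · exact Continuous.measurable (by fun_prop)
    · exact Filter.Eventually.of_forall fun a => (measurePreserving_add_right volume _).map_eq
  have hball : volume (Φ ⁻¹' Metric.closedBall 0 1) = ENNReal.ofReal (ballVolume (m + 1)) := by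
    rw [hΦm.measure_preimage measurableSet_closedBall.nullMeasurableSet, ofReal_ballVolume]
  have hmain : (fun z : ℝ × EuclideanSpace ℝ (Fin m) => (b * l * z.1, (α * l) • z.2)) ''
      (Φ ⁻¹' Metric.closedBall 0 1) ⊆ (Φ ∘ σ) ⁻¹' polarAt K x := by
    rintro _ ⟨⟨τ, w⟩, hτ, rfl⟩ z hz
    have hτw : τ ^ 2 + ‖w‖ ^ 2 ≤ 1 := by
      have h1 : ‖Φ (τ, w)‖ ≤ 1 := by simpa using hτ
      have h2 : ‖Φ (τ, w)‖ ^ 2 = τ ^ 2 + ‖w‖ ^ 2 := by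
        rw [← real_inner_self_eq_norm_sq, hΦ, real_inner_self_eq_norm_sq]; ring
      rw [← h2]
      exact pow_le_one₀ (norm_nonneg _) h1
    obtain ⟨ζ, hζ1, hζ2, hζ3⟩ := hcoord z
    set s : ℝ := b * l * τ + b with hs
    have hτ1 : -1 ≤ τ := by nlinarith [sq_nonneg ‖w‖]
    have hw1 : ‖w‖ ≤ 1 := by nlinarith [norm_nonneg w]
    have hsl : b * (1 - l) ≤ s := by rw [hs]; nlinarith [mul_pos hbpos hl0]
    have hspos : 0 < s := lt_of_lt_of_le (mul_pos hbpos (by linarith)) hsl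
    have hzx : z - x = Φ (ξ.1 - ζ.1, ξ.2 - ζ.2) := by
      have : (ξ.1 - ζ.1, ξ.2 - ζ.2) = ξ - ζ := rfl
      rw [this, map_sub, ← hξ1, ← hζ1]; abel
    have hval : inner ℝ ((Φ ∘ σ) (b * l * τ, (α * l) • w)) (z - x) =
        s * (ξ.1 - ζ.1) + inner ℝ ((α * l) • w - (s / R) • ξ.2) (ξ.2 - ζ.2) := by
      rw [hzx, Function.comp, hΦ]
      simp only [σ, neg_smul, ← sub_eq_add_neg, ← hs]
    rw [hval]
    refine polar_paraboloid hR hspos (hξ2 ▸ hxh) ?_ ?_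
    · have h1 : s = b * (1 + l * τ) := by rw [hs]; ring
      have h2 : R * ‖(α * l) • w‖ ^ 2 = b * l ^ 2 * ‖w‖ ^ 2 := by
        rw [norm_smul, mul_pow, Real.norm_eq_abs, sq_abs, mul_pow, hb, ← hα2]; ring
      have h3 : 2 * h * s ^ 2 = b * (1 + l * τ) ^ 2 := by
        rw [h1, hb]; field_simp
      rw [h2, h3, h1]
      -- After division by `b` and cancellation of `2lτ`, the ellipsoid condition is exactly this.
      have h4 : l ^ 2 * (τ ^ 2 + ‖w‖ ^ 2) ≤ 1 := by
        calc l ^ 2 * (τ ^ 2 + ‖w‖ ^ 2) ≤ 1 * 1 := by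
              gcongr
              exact pow_le_one₀ hl0.le hl.le
          _ = 1 := one_mul 1
      nlinarith
    · rcases hfar z hz with h1 | h1
      · left
        rw [hζ3, hζ2] at h1
        nlinarith [sq_nonneg ζ.1]
      · right
        rw [hζ2] at h1
        have hζle : ‖ζ.2‖ ≤ ‖z - p‖ :=
          abs_le_of_sq_le_sq' (by nlinarith [sq_nonneg ζ.1]) (norm_nonneg _) |>.2
        set y := (α * l) • w - (s / R) • ξ.2 with hy
        have hyn : 2 * R * ‖y‖ ≤ ρ * s := by
          exact norm_shear_le hR hh hspos hρ.le hl0 hl hsl hhρ hl2 hw1 hξn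
        have hin : -(‖y‖ * ‖ζ.2‖) ≤ inner ℝ y ζ.2 :=
          neg_le_of_abs_le (abs_real_inner_le_norm y ζ.2)
        have hfin : 2 * R * (‖y‖ * ‖ζ.2‖) ≤ 2 * R * (s * ζ.1) := by
          calc 2 * R * (‖y‖ * ‖ζ.2‖) = (2 * R * ‖y‖) * ‖ζ.2‖ := by ring
            _ ≤ (ρ * s) * ‖z - p‖ := by gcongr
            _ = s * (‖z - p‖ * ρ) := by ring
            _ ≤ s * (2 * R * ζ.1) := by gcongr
            _ = _ := by ring
        have := le_of_mul_le_mul_left hfin (by positivity)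
        linarith
  calc ENNReal.ofReal (l ^ (m + 1) * b * α ^ m * ballVolume (m + 1))
      = ENNReal.ofReal ((b * l) * (α * l) ^ m) * volume (Φ ⁻¹' Metric.closedBall 0 1) := by
        rw [hball, ← ENNReal.ofReal_mul (by positivity)]
        congr 1; ring
    _ = volume ((fun z : ℝ × EuclideanSpace ℝ (Fin m) => (b * l * z.1, (α * l) • z.2)) ''
          (Φ ⁻¹' Metric.closedBall 0 1)) :=
        (volume_image_prod_smul (by positivity) (by positivity) _).symm
    _ ≤ volume ((Φ ∘ σ) ⁻¹' polarAt K x) := measure_mono hmain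
    _ ≤ volume (polarAt K x) := le_volume_of_measurePreserving (hΦm.comp hσ) _

/-! ### The product of the two volumes -/

/-- The powers of `h` and `R` cancel as in the model. The loss is `l ^ (m + 1)` from shrinking the
ellipsoid and `l ^ m` from comparing the widths of the two paraboloids, which explains the exponent
in `hlm`. -/
theorem lt_volume_polarAt_mul_volume_cap {m : ℕ} {K : Set (EuclideanSpace ℝ (Fin (m + 1)))}
    (hK : Convex ℝ K) {p u x : EuclideanSpace ℝ (Fin (m + 1))} (hu : ‖u‖ = 1) (hp : p ∈ K)
    (hx : x ∈ K) {r R ρ h l : ℝ} (hρ : 0 < ρ) (hr : 0 < r) (hrR : r ≤ R) (hRr : l * R ≤ r)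
    (hh : 0 < h) (hxh : inner ℝ (p - x) u ≤ h) (hl0 : 0 < l) (hl : l < 1)
    (hlm : 1 / 2 < l ^ (2 * m + 1)) (hhρ : 32 * R * h ≤ (1 - l) ^ 2 * ρ ^ 2)
    (hhr : h ≤ 2 * (1 - l) * r)
    (hout : ∀ z ∈ K, ‖z - p‖ ≤ ρ → ‖z - p‖ ^ 2 ≤ 2 * R * inner ℝ (p - z) u)
    (hin : ∀ z, ‖z - p‖ ≤ ρ → ‖z - p‖ ^ 2 ≤ 2 * r * inner ℝ (p - z) u → z ∈ K) :
    ENNReal.ofReal (ballVolume m * ballVolume (m + 1) / (2 * (m + 2))) <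
      volume (polarAt K x) * volume {z | z ∈ K ∧ inner ℝ (p - z) u ≤ h} := by
  have hR : 0 < R := hr.trans_le hrR
  have hl2 : (1 - l) ^ 2 * ρ ^ 2 ≤ ρ ^ 2 :=
    mul_le_of_le_one_left (by positivity) (pow_le_one₀ (by linarith) (by linarith))
  have hcap := le_volume_cap hu hρ.le hh.le (by nlinarith [mul_pos hl0 hr]) (by
    have : r * h ≤ R * h := by gcongr
    nlinarith [mul_pos hR hh]) hin
  have hpol := le_volume_polarAt hK hu hp hx hρ hR hh hxh hl0 hl hhρ hout
  refine lt_of_lt_of_le ?_ (mul_le_mul' hpol hcap)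
  have v1 := ballVolume_pos m
  have v2 := ballVolume_pos (m + 1)
  rw [← ENNReal.ofReal_mul (by positivity)]
  -- From `hhr`, `2r - h ≥ 2lr`, and `lR ≤ r` turns this into `2l²R`.
  have hsq : l * √(2 * h * R) ≤ √((2 * r - h) * h) := by
    rw [← Real.sqrt_sq hl0.le, ← Real.sqrt_mul (by positivity)]
    apply Real.sqrt_le_sqrt
    have h1 : l ^ 2 * R ≤ l * r := by nlinarith
    nlinarith
  set q := √(2 * h * R) with hq
  have hqpos : 0 < q := by positivity
  have hge : l ^ (2 * m + 1) * (ballVolume m * ballVolume (m + 1) / (m + 2)) ≤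
      l ^ (m + 1) * (1 / (2 * h)) * (1 / q) ^ m * ballVolume (m + 1) *
      (ballVolume m * (√((2 * r - h) * h) ^ m * h * (2 / (m + 2)))) := by
    calc l ^ (2 * m + 1) * (ballVolume m * ballVolume (m + 1) / (m + 2))
        = l ^ (m + 1) * (1 / (2 * h)) * (1 / q) ^ m * ballVolume (m + 1) *
      (ballVolume m * ((l * q) ^ m * h * (2 / (m + 2)))) := by
          rw [one_div_pow, mul_pow]
          field_simp
          ring
      _ ≤ _ := by gcongr
  apply (ENNReal.ofReal_lt_ofReal_iff_of_nonneg (by positivity)).2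
  refine lt_of_lt_of_le ?_ hge
  calc ballVolume m * ballVolume (m + 1) / (2 * (m + 2))
      = 1 / 2 * (ballVolume m * ballVolume (m + 1) / (m + 2)) := by field_simp
    _ < _ := by gcongr

/-- The previous estimate in linearly transformed coordinates. -/
theorem lt_volume_polarAt_mul_volume_cap_of_linear {m : ℕ}
    {K : Set (EuclideanSpace ℝ (Fin (m + 1)))} (hK : Convex ℝ K)
    (L : EuclideanSpace ℝ (Fin (m + 1)) ≃L[ℝ] EuclideanSpace ℝ (Fin (m + 1)))
    (hL : ∀ y z, inner ℝ (L y) z = inner ℝ y (L z))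
    {p u x : EuclideanSpace ℝ (Fin (m + 1))} (hu : ‖u‖ = 1) (hp : p ∈ K)
    (hx : x ∈ K) {r R ρ h l : ℝ} (hρ : 0 < ρ) (hr : 0 < r) (hrR : r ≤ R) (hRr : l * R ≤ r)
    (hh : 0 < h) (hxh : inner ℝ (p - x) u ≤ h) (hl0 : 0 < l) (hl : l < 1)
    (hlm : 1 / 2 < l ^ (2 * m + 1)) (hhρ : 32 * R * h ≤ (1 - l) ^ 2 * ρ ^ 2)
    (hhr : h ≤ 2 * (1 - l) * r * ‖L.symm u‖ ^ 2)
    (hout : ∀ z ∈ K, ‖L (z - p)‖ ≤ ρ → ‖L (z - p)‖ ^ 2 ≤ 2 * R * inner ℝ (p - z) u)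
    (hin : ∀ z, ‖L (z - p)‖ ≤ ρ → ‖L (z - p)‖ ^ 2 ≤ 2 * r * inner ℝ (p - z) u → z ∈ K) :
    ENNReal.ofReal (ballVolume m * ballVolume (m + 1) / (2 * (m + 2))) <
      volume (polarAt K x) * volume {z | z ∈ K ∧ inner ℝ (p - z) u ≤ h} := by
  set c := ‖L.symm u‖ with hc
  have hcpos : 0 < c := by
    rw [hc, norm_pos_iff]
    intro h0
    have : u = 0 := by simpa using h0
    simp [this] at hu
  have hinner : ∀ z, inner ℝ (L p - L z) (c⁻¹ • L.symm u) = inner ℝ (p - z) u / c := by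
    intro z
    rw [inner_smul_right, ← map_sub, hL, L.apply_symm_apply]
    field_simp
  have hKL : Convex ℝ (L '' K) := hK.linear_image L.toLinearEquiv.toLinearMap
  -- The unit normal of `L '' K` at `L p` is `L⁻¹u / c`. Heights are divided by `c` and the radii
  -- multiplied by `c`, so products of radius and height do not change.
  have key := lt_volume_polarAt_mul_volume_cap hKL (p := L p) (u := c⁻¹ • L.symm u) (x := L x)
    (r := r * c) (R := R * c) (ρ := ρ) (h := h / c) (l := l)
    (by rw [norm_smul, norm_inv, norm_norm, ← hc]; field_simp)
    (Set.mem_image_of_mem _ hp) (Set.mem_image_of_mem _ hx) hρ (by positivity) (by gcongr)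
    (by rw [← mul_assoc]; gcongr) (by positivity)
    (by rw [hinner]; gcongr) hl0 hl hlm
    (by convert hhρ using 1; field_simp)
    (by rw [div_le_iff₀ hcpos]; calc h ≤ _ := hhr
          _ = _ := by ring)
    (by
      rintro _ ⟨z, hz, rfl⟩ hzp
      rw [← map_sub] at hzp ⊢
      rw [hinner]
      convert hout z hz hzp using 1
      field_simp)
    (by
      intro z hzp hz
      obtain ⟨z, rfl⟩ := L.surjective z
      rw [← map_sub] at hzp hz
      rw [hinner] at hz
      refine Set.mem_image_of_mem _ (hin z hzp ?_)
      convert hz using 1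
      field_simp)
  have hdet : (L : EuclideanSpace ℝ (Fin (m + 1)) →L[ℝ] EuclideanSpace ℝ (Fin (m + 1))).det ≠ 0 :=
    L.toLinearEquiv.isUnit_det'.ne_zero
  have e1 : polarAt (L '' K) (L x) = L ⁻¹' polarAt K x := by
    ext y
    simp only [polarAt, Set.mem_preimage, Set.mem_ofPred_eq, Set.forall_mem_image, ← map_sub, hL]
  have e2 : {z | z ∈ L '' K ∧ inner ℝ (L p - z) (c⁻¹ • L.symm u) ≤ h / c} =
      L '' {z | z ∈ K ∧ inner ℝ (p - z) u ≤ h} := by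
    ext z
    obtain ⟨z, rfl⟩ := L.surjective z
    simp only [Set.mem_ofPred_eq, hinner, L.injective.mem_set_image, div_le_div_iff_of_pos_right hcpos]
  set d := (L : EuclideanSpace ℝ (Fin (m + 1)) →L[ℝ] EuclideanSpace ℝ (Fin (m + 1))).det
  have e3 : volume (L ⁻¹' polarAt K x) = ENNReal.ofReal |d⁻¹| * volume (polarAt K x) :=
    Measure.addHaar_preimage_continuousLinearMap volume hdet (polarAt K x)
  have e5 : volume (L '' {z | z ∈ K ∧ inner ℝ (p - z) u ≤ h}) =
      ENNReal.ofReal |d| * volume {z | z ∈ K ∧ inner ℝ (p - z) u ≤ h} :=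
    Measure.addHaar_image_continuousLinearMap volume
      (L : EuclideanSpace ℝ (Fin (m + 1)) →L[ℝ] EuclideanSpace ℝ (Fin (m + 1))) _
  rw [e1, e2, e3, e5] at key
  -- Polar body and cap scale by reciprocal determinants.
  have e4 : ENNReal.ofReal |d⁻¹| * ENNReal.ofReal |d| = 1 := by
    rw [← ENNReal.ofReal_mul (abs_nonneg _), ← abs_mul, inv_mul_cancel₀ hdet]; simp
  calc _ < _ := key
    _ = (ENNReal.ofReal |d⁻¹| * ENNReal.ofReal |d|) * (volume (polarAt K x) *
      volume {z | z ∈ K ∧ inner ℝ (p - z) u ≤ h}) := by ring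
    _ = _ := by rw [e4, one_mul]

/-! ### Curvature and positive definite defining functions -/

/-- A symmetric square root of a positive definite map. -/
theorem exists_symmetric_sqrt {n : ℕ}
    {A : EuclideanSpace ℝ (Fin n) →L[ℝ] EuclideanSpace ℝ (Fin n)}
    (hA : ∀ v w, inner ℝ (A v) w = inner ℝ (A w) v) (hpos : ∀ v, v ≠ 0 → 0 < inner ℝ (A v) v) :
    ∃ L : EuclideanSpace ℝ (Fin n) ≃L[ℝ] EuclideanSpace ℝ (Fin n),
      (∀ y z, inner ℝ (L y) z = inner ℝ y (L z)) ∧ ∀ z, ‖L z‖ ^ 2 = inner ℝ (A z) z := by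
  have hT : A.toLinearMap.IsSymmetric := fun v w => by
    simpa [real_inner_comm] using hA v w
  have hn : finrank ℝ (EuclideanSpace ℝ (Fin n)) = n := by simp
  set b := hT.eigenvectorBasis hn with hb
  set e := hT.eigenvalues hn with he
  have hAb : ∀ i, A (b i) = e i • b i := fun i => hT.apply_eigenvectorBasis hn i
  have hepos : ∀ i, 0 ≤ e i := by
    intro i
    have h := hpos (b i) (b.orthonormal.ne_zero i)
    rw [hAb, inner_smul_left, real_inner_self_eq_norm_sq, b.orthonormal.norm_eq_one] at h
    simpa using h.le
  let S : EuclideanSpace ℝ (Fin n) →ₗ[ℝ] EuclideanSpace ℝ (Fin n) :=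
    ∑ i, √(e i) • (innerₗ (EuclideanSpace ℝ (Fin n)) (b i)).smulRight (b i)
  have hS : ∀ z, S z = ∑ i, (√(e i) * inner ℝ (b i) z) • b i := by
    intro z
    simp [S, LinearMap.sum_apply, smul_smul]
  have hSsymm : ∀ y z, inner ℝ (S y) z = inner ℝ y (S z) := by
    intro y z
    rw [hS, hS, sum_inner, inner_sum]
    refine Finset.sum_congr rfl fun i _ => ?_
    rw [inner_smul_left, inner_smul_right, real_inner_comm y]
    simp only [conj_trivial]
    ring
  have hSb : ∀ z i, inner ℝ (b i) (S z) = √(e i) * inner ℝ (b i) z := by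
    intro z i
    rw [hS, b.orthonormal.inner_right_fintype]
  have hSn : ∀ z, ‖S z‖ ^ 2 = inner ℝ (A z) z := by
    intro z
    rw [← real_inner_self_eq_norm_sq, ← b.sum_inner_mul_inner, ← b.sum_inner_mul_inner (A z) z]
    refine Finset.sum_congr rfl fun i _ => ?_
    rw [real_inner_comm, hSb, hA, hAb, inner_smul_left, real_inner_comm]
    simp only [conj_trivial, real_inner_comm (b i) z]
    have := Real.mul_self_sqrt (hepos i)
    linear_combination (inner ℝ (b i) z) ^ 2 * this
  have hinj : Function.Injective S := by
    rw [← LinearMap.ker_eq_bot, LinearMap.ker_eq_bot']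
    intro z hz
    by_contra hne
    have h := hpos z hne
    rw [← hSn, hz] at h
    simp at h
  exact ⟨(LinearEquiv.ofInjectiveEndo S hinj).toContinuousLinearEquiv, hSsymm, hSn⟩

variable {n : ℕ}

theorem contDiffAt_gradient {g : EuclideanSpace ℝ (Fin n) → ℝ} {x : EuclideanSpace ℝ (Fin n)}
    (hg : ContDiffAt ℝ 2 g x) : ContDiffAt ℝ 1 (∇ g) x :=
  (InnerProductSpace.toDual ℝ
    (EuclideanSpace ℝ (Fin n))).symm.toContinuousLinearEquiv.contDiff.contDiffAt.comp x
    (hg.fderiv_right (m := 1) (by norm_num))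

theorem eventually_differentiableAt {g : EuclideanSpace ℝ (Fin n) → ℝ}
    {x : EuclideanSpace ℝ (Fin n)} (hg : ContDiffAt ℝ 2 g x) :
    ∀ᶠ y in 𝓝 x, DifferentiableAt ℝ g y := by
  filter_upwards [hg.eventually (by simp)] with y hy
  exact hy.differentiableAt (by simp)

/-- The second fundamental form of the boundary of a convex set is positive semidefinite. -/
theorem IsDefiningFunction.second_nonneg {K : Set (EuclideanSpace ℝ (Fin n))}
    (hK : Convex ℝ K) {g : EuclideanSpace ℝ (Fin n) → ℝ} {x : EuclideanSpace ℝ (Fin n)}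
    (hg : IsDefiningFunction 2 K g x) {v : EuclideanSpace ℝ (Fin n)}
    (hv : inner ℝ (∇ g x) v = 0) : 0 ≤ inner ℝ (fderiv ℝ (∇ g) x v) v := by
  by_contra! hneg
  have hC : ContDiffAt ℝ 2 g x := by exact_mod_cast hg.contDiffAt
  have n1 : 0 < ‖∇ g x‖ ^ 2 := by have := norm_pos_iff.mpr hg.gradient_ne_zero; positivity
  obtain ⟨ε, hε, hε2⟩ : ∃ ε : ℝ, 0 < ε ∧
      inner ℝ (fderiv ℝ (∇ g) x v) v + 2 * ε * ‖∇ g x‖ ^ 2 < 0 := by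
    refine ⟨-inner ℝ (fderiv ℝ (∇ g) x v) v / (4 * ‖∇ g x‖ ^ 2), by
      apply div_pos <;> linarith, ?_⟩
    have : 2 * (-inner ℝ (fderiv ℝ (∇ g) x v) v / (4 * ‖∇ g x‖ ^ 2)) * ‖∇ g x‖ ^ 2 =
        -inner ℝ (fderiv ℝ (∇ g) x v) v / 2 := by
      generalize ‖∇ g x‖ ^ 2 = N at n1
      field_simp
      ring
    linarith
  -- With this sign the parabola bends outwards, yet stays in `K` for small `t`. The midpoint of its
  -- points at `t` and `-t` is `x + t²ε∇g(x)`, where `g` is positive, contradicting convexity.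
  set w := -(ε • ∇ g x) with hw
  obtain ⟨d1, s1, c1⟩ := deriv_parabola hC v w
  rw [hv] at d1
  have L1 := isLocalMax_of_deriv_deriv_neg (by
    rw [s1, hw, inner_neg_right, inner_smul_right, real_inner_self_eq_norm_sq]; linarith) d1 c1
  have ht : Filter.Tendsto (fun t : ℝ => x + t • v - t ^ 2 • w) (𝓝 0) (𝓝 x) := by
    have : ContinuousAt (fun t : ℝ => x + t • v - t ^ 2 • w) 0 := by fun_prop
    simpa using this.tendsto
  have hmem : ∀ᶠ t in 𝓝 (0 : ℝ), x + t • v - t ^ 2 • w ∈ K := by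
    filter_upwards [L1, ht.eventually hg.mem_iff] with t a1 m1
    simp only [zero_smul, add_zero, ne_eq, OfNat.ofNat_ne_zero, not_false_eq_true, zero_pow,
      sub_zero, hg.eq_zero] at a1
    exact m1.mpr a1
  have hneg0 : Filter.Tendsto (fun t : ℝ => -t) (𝓝 0) (𝓝 0) := by
    simpa using (continuous_neg (G := ℝ)).tendsto 0
  have hmid : ∀ᶠ t in 𝓝 (0 : ℝ), x + t ^ 2 • (ε • ∇ g x) ∈ K := by
    filter_upwards [hmem, hneg0.eventually hmem] with t h1 h2
    have h := hK h1 h2 (a := 1 / 2) (b := 1 / 2) (by norm_num) (by norm_num) (by norm_num)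
    convert h using 1
    rw [hw]
    module
  obtain ⟨e1, -, -⟩ := deriv_parabola hC (ε • ∇ g x) 0
  simp only [smul_zero, sub_zero] at e1
  have e2 := eventually_nhdsWithin_sign_eq_of_deriv_pos
    (f := fun t : ℝ => g (x + t • (ε • ∇ g x))) (x₀ := 0)
    (by rw [e1, inner_smul_right, real_inner_self_eq_norm_sq]; positivity)
    (by simpa using hg.eq_zero)
  have hsq : Filter.Tendsto (fun t : ℝ => t ^ 2) (𝓝 0) (𝓝 0) := by
    simpa using (continuous_pow (M := ℝ) 2).tendsto 0
  have ht2 : Filter.Tendsto (fun t : ℝ => x + t ^ 2 • (ε • ∇ g x)) (𝓝 0) (𝓝 x) := by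
    have : ContinuousAt (fun t : ℝ => x + t ^ 2 • (ε • ∇ g x)) 0 := by fun_prop
    simpa using this.tendsto
  have hall := ((hmid.and (hsq.eventually e2)).and (ht2.eventually hg.mem_iff)).filter_mono
    (nhdsWithin_le_nhds (s := Set.Ioi 0))
  obtain ⟨t, ⟨⟨h1, h2⟩, h3⟩, htpos⟩ := (hall.and self_mem_nhdsWithin).exists
  have htpos : (0 : ℝ) < t := htpos
  rw [sub_zero, sign_pos (a := t ^ 2) (by positivity)] at h2
  exact absurd (h3.mp h1) (not_le.mpr (sign_eq_one_iff.mp h2))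

/-- A nonnegative quadratic form that vanishes at `v` has `v` in its kernel. -/
theorem inner_eq_zero_of_nonneg {T : Submodule ℝ (EuclideanSpace ℝ (Fin n))}
    {A : EuclideanSpace ℝ (Fin n) →L[ℝ] EuclideanSpace ℝ (Fin n)}
    (hA : ∀ v w, inner ℝ (A v) w = inner ℝ (A w) v) (hT : ∀ v ∈ T, 0 ≤ inner ℝ (A v) v)
    {v w : EuclideanSpace ℝ (Fin n)} (hv : v ∈ T) (hw : w ∈ T) (h0 : inner ℝ (A v) v = 0) :
    inner ℝ (A v) w = 0 := by
  have h : ∀ t : ℝ, 0 ≤ inner ℝ (A w) w * (t * t) + (2 * inner ℝ (A v) w) * t + 0 := by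
    intro t
    have h1 := hT (v + t • w) (T.add_mem hv (T.smul_mem t hw))
    simp only [map_add, map_smul, inner_add_left, inner_add_right, inner_smul_left,
      inner_smul_right, conj_trivial, h0, hA w v] at h1
    linarith
  have hd := discrim_le_zero h
  rw [discrim] at hd
  nlinarith [sq_nonneg (inner ℝ (A v) w)]

/-- By semidefiniteness, a tangent vector on which the form vanishes lies in the kernel of the
compressed second derivative. The determinant of that compression, suitably scaled, is the
curvature, so the kernel is trivial. -/
theorem IsDefiningFunction.second_pos {K : Set (EuclideanSpace ℝ (Fin n))}
    (hK : Convex ℝ K) {g : EuclideanSpace ℝ (Fin n) → ℝ} {x : EuclideanSpace ℝ (Fin n)}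
    (hg : IsDefiningFunction 2 K g x) (hcurv : 0 < gaussCurvature K x)
    {v : EuclideanSpace ℝ (Fin n)}
    (hv : inner ℝ (∇ g x) v = 0) (hv0 : v ≠ 0) : 0 < inner ℝ (fderiv ℝ (∇ g) x v) v := by
  refine lt_of_le_of_ne (hg.second_nonneg hK hv) fun h0 => hv0 ?_
  rw [gaussCurvature_eq hg, levelSetCurvature, compressionDet] at hcurv
  have hmem : ∀ {u : EuclideanSpace ℝ (Fin n)}, u ∈ (Submodule.span ℝ {∇ g x})ᗮ ↔
      inner ℝ (∇ g x) u = 0 := Submodule.mem_orthogonal_singleton_iff_inner_right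
  set T := (Submodule.span ℝ {∇ g x})ᗮ with hT
  have hinj := (LinearMap.isUnit_iff_ker_eq_bot _).mp
    ((LinearMap.isUnit_iff_isUnit_det _).mpr (isUnit_iff_ne_zero.mpr hcurv.ne'))
  rw [LinearMap.ker_eq_bot'] at hinj
  have h1 := hinj ⟨v, hmem.mpr hv⟩ (by
    apply ext_inner_right ℝ
    intro w
    have := inner_eq_zero_of_nonneg (T := T)
      (fun v w => fderiv_gradient_symm (by exact_mod_cast hg.contDiffAt) v w)
      (fun v hv => hg.second_nonneg hK (hmem.mp hv)) (hmem.mpr hv) w.2 h0.symm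
    simp [inner_smul_left, this])
  simpa using congrArg Subtype.val h1

/-- A form that is positive on the orthogonal complement of `G` becomes positive definite after
adding a large multiple of `⟨G, ·⟩²`. -/
theorem exists_add_sq_pos (A : EuclideanSpace ℝ (Fin n) →L[ℝ] EuclideanSpace ℝ (Fin n))
    (G : EuclideanSpace ℝ (Fin n)) (hA : ∀ v, inner ℝ G v = 0 → v ≠ 0 → 0 < inner ℝ (A v) v) :
    ∃ M : ℝ, ∀ v, v ≠ 0 → 0 < inner ℝ (A v) v + M * inner ℝ G v ^ 2 := by
  by_contra! hcon
  -- If every multiple fails, these nested compact subsets of the sphere are nonempty. A common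
  -- point must be orthogonal to `G`, where the form is positive.
  let S : ℕ → Set (EuclideanSpace ℝ (Fin n)) := fun k =>
    Metric.sphere 0 1 ∩ {v | inner ℝ (A v) v + k * inner ℝ G v ^ 2 ≤ 0}
  have hcl : ∀ k : ℕ, IsClosed {v : EuclideanSpace ℝ (Fin n) |
      inner ℝ (A v) v + k * inner ℝ G v ^ 2 ≤ 0} := fun k =>
    isClosed_le (by fun_prop) (by fun_prop)
  obtain ⟨v, hv⟩ := IsCompact.nonempty_iInter_of_sequence_nonempty_isCompact_isClosed S
    (fun k => by
      rintro v ⟨h1, h2⟩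
      refine ⟨h1, le_trans ?_ (Set.mem_ofPred_eq ▸ h2)⟩
      gcongr
      simp)
    (fun k => by
      obtain ⟨v, hv0, hv⟩ := hcon k
      have hn : 0 < ‖v‖ := norm_pos_iff.mpr hv0
      refine ⟨‖v‖⁻¹ • v, by simp [norm_smul, hn.ne'], ?_⟩
      simp only [Set.mem_ofPred_eq, map_smul, inner_smul_left, inner_smul_right, conj_trivial]
      have : ‖v‖⁻¹ * (‖v‖⁻¹ * inner ℝ (A v) v) + k * (‖v‖⁻¹ * inner ℝ G v) ^ 2 =
        ‖v‖⁻¹ ^ 2 * (inner ℝ (A v) v + k * inner ℝ G v ^ 2) := by ring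
      rw [this]
      exact mul_nonpos_of_nonneg_of_nonpos (by positivity) hv)
    ((isCompact_sphere _ _).inter_right (hcl 0))
    (fun k => Metric.isClosed_sphere.inter (hcl k))
  rw [Set.mem_iInter] at hv
  have hv1 : ‖v‖ = 1 := by simpa using (hv 0).1
  have hv0 : v ≠ 0 := by rintro rfl; simp at hv1
  have hk : ∀ k : ℕ, inner ℝ (A v) v + k * inner ℝ G v ^ 2 ≤ 0 := fun k => (hv k).2
  have hG : inner ℝ G v = 0 := by
    by_contra hne
    have hpos : 0 < inner ℝ G v ^ 2 := by positivity
    obtain ⟨k, hk2⟩ := exists_nat_gt (-inner ℝ (A v) v / inner ℝ G v ^ 2)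
    rw [div_lt_iff₀ hpos] at hk2
    linarith [hk k]
  have := hA v hG hv0
  have := hk 0
  simp [hG] at this
  linarith

/-- A boundary point of positive curvature has a defining function with positive definite
second derivative. -/
theorem exists_isDefiningFunction_pos {K : Set (EuclideanSpace ℝ (Fin n))}
    (hK : Convex ℝ K) {g : EuclideanSpace ℝ (Fin n) → ℝ} {x : EuclideanSpace ℝ (Fin n)}
    (hg : IsDefiningFunction 2 K g x) (hcurv : 0 < gaussCurvature K x) :
    ∃ f, IsDefiningFunction 2 K f x ∧ ∀ v, v ≠ 0 → 0 < inner ℝ (fderiv ℝ (∇ f) x v) v := by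
  have hC : ContDiffAt ℝ 2 g x := by exact_mod_cast hg.contDiffAt
  obtain ⟨M, hM⟩ := exists_add_sq_pos (fderiv ℝ (∇ g) x) (∇ g x)
    (fun v h1 h2 => hg.second_pos hK hcurv h1 h2)
  -- Adding `M/2 · g²` keeps the zero set and the sign near `x`, and adds `M ⟨∇g, ·⟩²` to the second
  -- derivative at `x`.
  have hgrad : ∀ᶠ y in 𝓝 x, ∇ (fun y => g y + M / 2 * g y ^ 2) y = (1 + M * g y) • ∇ g y := by
    filter_upwards [eventually_differentiableAt hC] with y hy
    have h := hy.hasGradientAt.hasFDerivAt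
    have h2 := h.add ((h.pow 2).const_mul (M / 2))
    apply HasGradientAt.gradient
    rw [hasGradientAt_iff_hasFDerivAt]
    convert! h2 using 1
    ext v
    simp
    ring
  have hx0 := hg.eq_zero
  have hgx : ∇ (fun y => g y + M / 2 * g y ^ 2) x = ∇ g x := by
    rw [hgrad.self_of_nhds, hx0]; simp
  refine ⟨fun y => g y + M / 2 * g y ^ 2, ⟨?_, ?_, ?_, ?_⟩, ?_⟩
  · have : ContDiffAt ℝ 2 (fun y => g y + M / 2 * g y ^ 2) x := by fun_prop
    exact_mod_cast this
  · simp [hx0]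
  · rw [hgx]; exact hg.gradient_ne_zero
  · have hcont : Filter.Tendsto (fun y => 1 + M / 2 * g y) (𝓝 x) (𝓝 1) := by
      have : ContinuousAt (fun y => 1 + M / 2 * g y) x := by
        have := hC.continuousAt
        fun_prop
      simpa [ContinuousAt, hx0] using this
    filter_upwards [hg.mem_iff, hcont.eventually (lt_mem_nhds one_pos)] with y h1 h2
    rw [h1]
    have : g y + M / 2 * g y ^ 2 = g y * (1 + M / 2 * g y) := by ring
    rw [this]
    constructor
    · intro h; exact mul_nonpos_of_nonpos_of_nonneg h h2.le
    · intro h; exact nonpos_of_mul_nonpos_left h h2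
  · intro v hv
    have h1 : HasFDerivAt (∇ g) (fderiv ℝ (∇ g) x) x :=
      ((contDiffAt_gradient hC).differentiableAt (by simp)).hasFDerivAt
    have h2 := ((hC.differentiableAt (by simp)).hasGradientAt.hasFDerivAt.const_mul M).const_add 1
    have h3 := (h2.smul h1).congr_of_eventuallyEq hgrad
    rw [h3.fderiv]
    have := hM v hv
    simp only [hx0, mul_zero, add_zero, one_smul, add_apply,
      ContinuousLinearMap.smulRight_apply, smul_apply,
      InnerProductSpace.toDual_apply_apply, inner_add_left, inner_smul_left, smul_eq_mul,
      conj_trivial]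
    convert this using 1
    ring

/-! ### Uniform estimates near a boundary point -/

/-- Second order Taylor expansion with locally uniform remainder. -/
theorem exists_taylor {g : EuclideanSpace ℝ (Fin n) → ℝ} {x : EuclideanSpace ℝ (Fin n)}
    (hg : ContDiffAt ℝ 2 g x) {η : ℝ} (hη : 0 < η) :
    ∃ ε > 0, ∀ p ∈ Metric.ball x ε, ∀ z ∈ Metric.ball x ε,
      |g z - g p - inner ℝ (∇ g p) (z - p) -
        1 / 2 * inner ℝ (fderiv ℝ (∇ g) x (z - p)) (z - p)| ≤ η * ‖z - p‖ ^ 2 := by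
  set A := fderiv ℝ (∇ g) x with hA
  -- Strict differentiability allows the base point `p` to vary while the second derivative stays
  -- frozen at `x`.
  have hstrict : HasStrictFDerivAt (∇ g) A x :=
    (contDiffAt_gradient hg).hasStrictFDerivAt (by simp)
  have h1 := hstrict.isLittleO.def hη
  rw [nhds_prod_eq] at h1
  obtain ⟨ε1, hε1, H1⟩ := (Metric.nhds_basis_ball.prod_self.eventually_iff).mp h1
  obtain ⟨ε2, hε2, H2⟩ := Metric.eventually_nhds_iff_ball.mp (eventually_differentiableAt hg)
  refine ⟨min ε1 ε2, lt_min hε1 hε2, fun p hp z hz => ?_⟩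
  have hseg : ∀ t ∈ Set.Icc (0 : ℝ) 1, p + t • (z - p) ∈ Metric.ball x (min ε1 ε2) :=
    fun t ht => (convex_ball x _).add_smul_sub_mem hp hz ht
  have hder : ∀ t ∈ Set.Icc (0 : ℝ) 1, HasDerivWithinAt
      (fun t : ℝ => g (p + t • (z - p)) - t * inner ℝ (∇ g p) (z - p) -
        t ^ 2 / 2 * inner ℝ (A (z - p)) (z - p))
      (inner ℝ (∇ g (p + t • (z - p)) - ∇ g p - A (p + t • (z - p) - p)) (z - p))
      (Set.Icc 0 1) t := by
    intro t ht
    have d0 : HasDerivAt (fun t : ℝ => p + t • (z - p)) (z - p) t := by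
      simpa using ((hasDerivAt_id t).smul_const (z - p)).const_add p
    have d1 := (H2 _ (Metric.ball_subset_ball (min_le_right _ _)
      (hseg t ht))).hasGradientAt.hasFDerivAt.comp_hasDerivAt t d0
    have d2 := (hasDerivAt_id t).mul_const (inner ℝ (∇ g p) (z - p))
    have d3 := ((hasDerivAt_pow 2 t).div_const 2).mul_const (inner ℝ (A (z - p)) (z - p))
    refine HasDerivAt.hasDerivWithinAt ?_
    convert! (d1.sub d2).sub d3 using 1
    simp [inner_sub_left, inner_smul_left]
  have hb : ∀ t ∈ Set.Ico (0 : ℝ) 1,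
      ‖inner ℝ (∇ g (p + t • (z - p)) - ∇ g p - A (p + t • (z - p) - p)) (z - p)‖ ≤
        η * ‖z - p‖ ^ 2 := by
    intro t ht
    have ht' : t ∈ Set.Icc (0 : ℝ) 1 := ⟨ht.1, ht.2.le⟩
    have h2 := H1 (x := (p + t • (z - p), p))
      ⟨Metric.ball_subset_ball (min_le_left _ _) (hseg t ht'),
        Metric.ball_subset_ball (min_le_left _ _) hp⟩
    refine (norm_inner_le_norm _ _).trans ?_
    calc _ ≤ (η * ‖p + t • (z - p) - p‖) * ‖z - p‖ := by gcongr
      _ = t * (η * ‖z - p‖ ^ 2) := by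
        rw [add_sub_cancel_left, norm_smul, Real.norm_of_nonneg ht.1]; ring
      _ ≤ 1 * (η * ‖z - p‖ ^ 2) := by gcongr; exact ht.2.le
      _ = _ := one_mul _
  have := norm_image_sub_le_of_norm_deriv_le_segment_01' hder hb
  convert this using 1
  simp
  congr 1
  ring

/-- At a boundary point a defining function vanishes. -/
theorem eq_zero_of_mem_frontier {K : Set (EuclideanSpace ℝ (Fin n))} (hK : IsClosed K)
    {g : EuclideanSpace ℝ (Fin n) → ℝ} {p : EuclideanSpace ℝ (Fin n)} (hp : p ∈ frontier K)
    (hg : ContinuousAt g p) (hmem : ∀ᶠ y in 𝓝 p, (y ∈ K ↔ g y ≤ 0)) : g p = 0 := by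
  have hpK : p ∈ K := hK.frontier_subset hp
  refine le_antisymm (hmem.self_of_nhds.mp hpK) ?_
  by_contra! hlt
  refine hp.2 (mem_interior_iff_mem_nhds.mpr ?_)
  filter_upwards [hmem, hg.eventually (gt_mem_nhds hlt)] with y h1 h2
  exact h1.mpr h2.le

/-- The gradient of a defining function is a positive multiple of the outer unit normal. -/
theorem gradient_eq_norm_smul {K : Set (EuclideanSpace ℝ (Fin n))}
    {g : EuclideanSpace ℝ (Fin n) → ℝ} {p u : EuclideanSpace ℝ (Fin n)}
    (hg : DifferentiableAt ℝ g p) (hmem : ∀ᶠ y in 𝓝 p, (y ∈ K ↔ g y ≤ 0)) (h0 : g p = 0)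
    (hne : ∇ g p ≠ 0) (hu : ‖u‖ = 1) (hsupp : ∀ z ∈ K, inner ℝ z u ≤ inner ℝ p u) :
    ∇ g p = ‖∇ g p‖ • u := by
  -- A direction in which `g` decreases enters `K`, so it cannot point beyond the supporting
  -- hyperplane.
  have key : ∀ v, inner ℝ (∇ g p) v < 0 → inner ℝ v u ≤ 0 := by
    intro v hv
    have d0 : HasDerivAt (fun t : ℝ => p + t • v) v 0 := by
      simpa using ((hasDerivAt_id (0 : ℝ)).smul_const v).const_add p
    have d1 : HasDerivAt (fun t : ℝ => g (p + t • v)) (inner ℝ (∇ g p) v) 0 := by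
      have h : HasFDerivAt g (InnerProductSpace.toDual ℝ _ (∇ g p)) (p + (0 : ℝ) • v) := by
        simpa using hg.hasGradientAt.hasFDerivAt
      simpa [Function.comp_def] using h.comp_hasDerivAt (0 : ℝ) d0
    have e1 := eventually_nhdsWithin_sign_eq_of_deriv_neg (f := fun t : ℝ => g (p + t • v))
      (x₀ := 0) (by rw [d1.deriv]; exact hv) (by simpa using h0)
    have ht : Filter.Tendsto (fun t : ℝ => p + t • v) (𝓝 0) (𝓝 p) := by
      simpa using d0.continuousAt.tendsto
    have e := (e1.and (ht.eventually hmem)).filter_mono (nhdsWithin_le_nhds (s := Set.Ioi 0))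
    obtain ⟨t, ⟨s1, m1⟩, htpos⟩ := (e.and self_mem_nhdsWithin).exists
    have htpos : (0 : ℝ) < t := htpos
    rw [zero_sub, sign_neg (neg_lt_zero.mpr htpos)] at s1
    have h := hsupp _ (m1.mpr (sign_eq_neg_one_iff.mp s1).le)
    rw [inner_add_left, inner_smul_left] at h
    simp only [conj_trivial] at h
    exact nonpos_of_mul_nonpos_right (by linarith) htpos
  set G := ∇ g p with hG
  have hGn : 0 < ‖G‖ := norm_pos_iff.mpr hne
  set e := ‖G‖⁻¹ • G with he
  have hen : ‖e‖ = 1 := by rw [he, norm_smul, norm_inv, norm_norm]; field_simp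
  have hGe : G = ‖G‖ • e := by rw [he, smul_smul]; field_simp; simp
  have heu : inner ℝ e u ≤ 1 := by simpa [hen, hu] using real_inner_le_norm e u
  have h1 : inner ℝ e u = 1 := by
    by_contra hne1
    have hlt : inner ℝ e u < 1 := lt_of_le_of_ne heu hne1
    -- If `e ≠ u`, the direction `u - e` decreases `g` but points strictly beyond the hyperplane.
    have h := key (u - e) (by
      rw [hGe, inner_smul_left, inner_sub_right, real_inner_self_eq_norm_sq, hen]
      simp only [conj_trivial]
      nlinarith)
    rw [inner_sub_left, real_inner_self_eq_norm_sq, hu] at h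
    linarith
  have h2 : e = u := (inner_eq_one_iff_of_norm_eq_one hen hu).mp h1
  rw [← h2]
  exact hGe

/-- The spare factor 2 of the model is converted here into a shrinking factor `l < 1`. -/
theorem exists_shrink_factor (k : ℕ) : ∃ l : ℝ, 0 < l ∧ l < 1 ∧ 1 / 2 < l ^ k := by
  have h : Filter.Tendsto (fun l : ℝ => l ^ k) (𝓝[<] 1) (𝓝 1) := by
    have := ((continuous_pow (M := ℝ) k).tendsto 1).mono_left (nhdsWithin_le_nhds (s := Set.Iio 1))
    simpa using this
  have h0 : ∀ᶠ l : ℝ in 𝓝[<] 1, 0 < l := nhdsWithin_le_nhds (lt_mem_nhds one_pos)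
  obtain ⟨l, ⟨h1, h2⟩, h3⟩ := ((h0.and (h.eventually (lt_mem_nhds
    (by norm_num : (1 / 2 : ℝ) < 1)))).and self_mem_nhdsWithin).exists
  exact ⟨l, h1, h3, h2⟩

set_option maxHeartbeats 1000000 in
/-- Near a boundary point of positive curvature, the product of the volumes of the polar body and
of a small cap is bounded below. -/
theorem exists_nhds_lt_volume_mul {m : ℕ} {K : Set (EuclideanSpace ℝ (Fin (m + 1)))}
    (hK : Convex ℝ K) (hcl : IsClosed K) {x₀ : EuclideanSpace ℝ (Fin (m + 1))}
    {g₀ : EuclideanSpace ℝ (Fin (m + 1)) → ℝ} (hg₀ : IsDefiningFunction 2 K g₀ x₀)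
    (hcurv : 0 < gaussCurvature K x₀) :
    ∃ V ∈ 𝓝 x₀, ∃ h₀ > 0, ∀ p ∈ V, p ∈ frontier K → ∀ u : EuclideanSpace ℝ (Fin (m + 1)),
      ‖u‖ = 1 → (∀ z ∈ K, inner ℝ z u ≤ inner ℝ p u) → ∀ x ∈ K, ∀ h, 0 < h → h ≤ h₀ →
      inner ℝ (p - x) u ≤ h →
      ENNReal.ofReal (ballVolume m * ballVolume (m + 1) / (2 * (m + 2))) <
        volume (polarAt K x) * volume {z | z ∈ K ∧ inner ℝ (p - z) u ≤ h} := by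
  obtain ⟨g, hg, hpos⟩ := exists_isDefiningFunction_pos hK hg₀ hcurv
  have hC : ContDiffAt ℝ 2 g x₀ := by exact_mod_cast hg.contDiffAt
  obtain ⟨L, hL, hLA⟩ := exists_symmetric_sqrt (fun v w => fderiv_gradient_symm hC v w) hpos
  obtain ⟨l, hl0, hl1, hlm⟩ := exists_shrink_factor (2 * m + 1)
  -- With this error, `1/2 - θ = (1 + l)/4` and `1/2 + θ = (3 - l)/4`. These give the radii `R =
  -- 2G/(1 + l)` and `r = 2G/(3 - l)`, and `lR ≤ r` amounts to `(1 - l)² ≥ 0`.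
  set θ : ℝ := (1 - l) / 4 with hθ
  have hθpos : 0 < θ := by rw [hθ]; linarith
  set N : ℝ := ‖(L.symm : EuclideanSpace ℝ (Fin (m + 1)) →L[ℝ] EuclideanSpace ℝ (Fin (m + 1)))‖ + 1
  have hNpos : 0 < N := by positivity
  have hN : ∀ z, ‖z‖ ≤ N * ‖L z‖ := by
    intro z
    have h := (L.symm : EuclideanSpace ℝ (Fin (m + 1)) →L[ℝ]
      EuclideanSpace ℝ (Fin (m + 1))).le_opNorm (L z)
    simp only [ContinuousLinearEquiv.coe_coe, ContinuousLinearEquiv.symm_apply_apply] at h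
    exact h.trans (by gcongr; simp [N])
  set N' : ℝ := ‖(L : EuclideanSpace ℝ (Fin (m + 1)) →L[ℝ] EuclideanSpace ℝ (Fin (m + 1)))‖ + 1
  have hN'pos : 0 < N' := by positivity
  have hN' : ∀ z, ‖z‖ ≤ N' * ‖L.symm z‖ := by
    intro z
    have h := (L : EuclideanSpace ℝ (Fin (m + 1)) →L[ℝ]
      EuclideanSpace ℝ (Fin (m + 1))).le_opNorm (L.symm z)
    simp only [ContinuousLinearEquiv.coe_coe, ContinuousLinearEquiv.apply_symm_apply] at h
    exact h.trans (by gcongr; simp [N'])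
  obtain ⟨ε₁, hε₁, htay⟩ := exists_taylor hC (η := θ / N ^ 2) (by positivity)
  set γ := ‖∇ g x₀‖ with hγ
  have hγpos : 0 < γ := norm_pos_iff.mpr hg.gradient_ne_zero
  have hgcont : Filter.Tendsto (fun y => ‖∇ g y‖) (𝓝 x₀) (𝓝 γ) :=
    (contDiffAt_gradient hC).continuousAt.norm
  obtain ⟨ε₂, hε₂, hloc⟩ := Metric.eventually_nhds_iff_ball.mp
    ((eventually_differentiableAt hC).and (hg.mem_iff.eventually_nhds.and
      ((hgcont.eventually (lt_mem_nhds (half_lt_self hγpos))).and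
        (hgcont.eventually (gt_mem_nhds (by linarith : γ < 2 * γ))))))
  set ε := min ε₁ ε₂ with hε
  have hεpos : 0 < ε := lt_min hε₁ hε₂
  set ρ := ε / (2 * N) with hρ
  have hρpos : 0 < ρ := by positivity
  have h1l : 0 < 1 - l := by linarith
  refine ⟨Metric.ball x₀ (ε / 2), Metric.ball_mem_nhds _ (by positivity),
    -- Since `γ/2 < G < 2γ`, one has `R ≤ 4γ` and `r ≥ γ/3`; also `‖L⁻¹u‖ ≥ 1/N'`. The two terms
    -- then ensure the two smallness conditions on `h` for all `p` at once.
    min ((1 - l) ^ 2 * ρ ^ 2 / (128 * γ)) (2 * (1 - l) * (γ / 3) / N' ^ 2), by positivity, ?_⟩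
  intro p hpV hpf u hu hsupp x hx h hh hh0 hxh
  have hpε : p ∈ Metric.ball x₀ ε := Metric.ball_subset_ball (by linarith) hpV
  obtain ⟨hdiff, hmem, hγ1, hγ2⟩ := hloc p (Metric.ball_subset_ball (min_le_right _ _) hpε)
  have hgp : g p = 0 := eq_zero_of_mem_frontier hcl hpf hdiff.continuousAt hmem
  set G := ‖∇ g p‖ with hG
  have hGpos : 0 < G := by linarith
  have hGu : ∇ g p = G • u :=
    gradient_eq_norm_smul hdiff hmem hgp (norm_pos_iff.mp hGpos) hu hsupp
  have hball : ∀ z, ‖L (z - p)‖ ≤ ρ → z ∈ Metric.ball x₀ ε := by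
    intro z hz
    have h1 : ‖z - p‖ ≤ ε / 2 := by
      calc ‖z - p‖ ≤ N * ‖L (z - p)‖ := hN _
        _ ≤ N * ρ := by gcongr
        _ = ε / 2 := by rw [hρ]; field_simp
    rw [Metric.mem_ball] at hpV ⊢
    calc dist z x₀ ≤ dist z p + dist p x₀ := dist_triangle _ _ _
      _ < ε / 2 + ε / 2 := by rw [dist_eq_norm z p]; linarith
      _ = ε := by ring
  have hexp : ∀ z, ‖L (z - p)‖ ≤ ρ →
      |g z + G * inner ℝ (p - z) u - 1 / 2 * ‖L (z - p)‖ ^ 2| ≤ θ * ‖L (z - p)‖ ^ 2 := by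
    intro z hz
    have h1 := htay p (Metric.ball_subset_ball (min_le_left _ _) hpε) z
      (Metric.ball_subset_ball (min_le_left _ _) (hball z hz))
    rw [hgp, hGu, inner_smul_left, ← hLA, ← neg_sub p z, inner_neg_right, real_inner_comm] at h1
    simp only [conj_trivial, neg_sub] at h1
    have h2 : θ / N ^ 2 * ‖z - p‖ ^ 2 ≤ θ * ‖L (z - p)‖ ^ 2 := by
      calc θ / N ^ 2 * ‖z - p‖ ^ 2 ≤ θ / N ^ 2 * (N * ‖L (z - p)‖) ^ 2 := by
            gcongr; exact hN _
        _ = _ := by field_simp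
    refine le_trans (le_of_eq ?_) (h1.trans h2)
    congr 1
    ring
  have hmemK : ∀ z, ‖L (z - p)‖ ≤ ρ → (z ∈ K ↔ g z ≤ 0) := fun z hz =>
    (hloc z (Metric.ball_subset_ball (min_le_right _ _) (hball z hz))).2.1.self_of_nhds
  have hr0 : γ / 3 ≤ 2 * G / (3 - l) := by
    rw [div_le_div_iff₀ (by norm_num) (by linarith)]; nlinarith
  have hR0 : 2 * G / (1 + l) ≤ 4 * γ := by
    rw [div_le_iff₀ (by linarith)]; nlinarith
  refine lt_volume_polarAt_mul_volume_cap_of_linear hK L hL hu (hcl.frontier_subset hpf) hx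
    (r := 2 * G / (3 - l)) (R := 2 * G / (1 + l)) hρpos (by apply div_pos <;> linarith)
    (by gcongr; linarith) ?_ hh hxh hl0 hl1 hlm ?_ ?_ ?_ ?_
  · rw [← mul_div_assoc, div_le_div_iff₀ (by linarith) (by linarith)]
    have : l * (3 - l) ≤ 1 + l := by nlinarith [sq_nonneg (1 - l)]
    nlinarith
  · have h1 := hh0.trans (min_le_left _ _)
    rw [le_div_iff₀ (by positivity)] at h1
    calc 32 * (2 * G / (1 + l)) * h ≤ 32 * (4 * γ) * h := by gcongr
      _ = h * (128 * γ) := by ring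
      _ ≤ _ := h1
  · have h1 := hh0.trans (min_le_right _ _)
    have h2 : 1 / N' ≤ ‖L.symm u‖ := by
      rw [div_le_iff₀ hN'pos, mul_comm, ← hu]; exact hN' u
    have h3 : 0 ≤ 2 * (1 - l) * (2 * G / (3 - l)) := mul_nonneg (by linarith) (by linarith)
    calc h ≤ _ := h1
      _ = 2 * (1 - l) * (γ / 3) * (1 / N') ^ 2 := by rw [one_div_pow]; ring
      _ ≤ _ := by gcongr
  · intro z hzK hz
    have h1 := (abs_le.mp (hexp z hz)).1
    have h2 := (hmemK z hz).mp hzK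
    have h3 : 2 * (2 * G / (1 + l)) * inner ℝ (p - z) u =
      (4 * (G * inner ℝ (p - z) u)) / (1 + l) := by ring
    rw [h3, le_div_iff₀ (by linarith)]
    rw [hθ] at h1
    linarith
  · intro z hz hz2
    refine (hmemK z hz).mpr ?_
    have h1 := (abs_le.mp (hexp z hz)).2
    have h3 : 2 * (2 * G / (3 - l)) * inner ℝ (p - z) u =
      (4 * (G * inner ℝ (p - z) u)) / (3 - l) := by ring
    rw [h3, le_div_iff₀ (by linarith)] at hz2
    rw [hθ] at h1
    linarith

/-! ### From local to global -/

/-- The caps of a given height of a convex body have volumes bounded away from zero. -/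
theorem exists_le_volume_cap {n : ℕ} {K : Set (EuclideanSpace ℝ (Fin n))} (hK : Convex ℝ K)
    (hc : IsCompact K) (hint : (interior K).Nonempty) {h : ℝ} (hh : 0 < h) :
    ∃ s > 0, ∀ p ∈ K, ∀ u : EuclideanSpace ℝ (Fin n), ‖u‖ = 1 →
      ENNReal.ofReal s ≤ volume {z | z ∈ K ∧ inner ℝ (p - z) u ≤ h} := by
  obtain ⟨c, hcK⟩ := hint
  obtain ⟨ε, hε, hball⟩ := Metric.nhds_basis_closedBall.mem_iff.mp
    (mem_interior_iff_mem_nhds.mp hcK)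
  obtain ⟨D, hD, hKD⟩ := hc.isBounded.exists_pos_norm_le
  -- The homothety with centre `p` and ratio `θ` maps `K` into itself and into distance `h` of `p`,
  -- so the cap contains the image of the inner ball.
  set θ := min 1 (h / (2 * D)) with hθ
  have hθpos : 0 < θ := by positivity
  have hθ1 : θ ≤ 1 := min_le_left _ _
  have hθ2 : θ * (2 * D) ≤ h := by
    rw [← le_div_iff₀ (by positivity)]; exact min_le_right _ _
  refine ⟨(θ * ε) ^ n * ballVolume n, mul_pos (by positivity) (ballVolume_pos n), ?_⟩
  intro p hp u hu
  rw [← volume_closedBall_eq (p + θ • (c - p)) (by positivity)]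
  refine measure_mono fun z hz => ?_
  have hw : p + θ⁻¹ • (z - p) ∈ K := by
    apply hball
    rw [mem_closedBall_iff_norm] at hz ⊢
    have h1 : p + θ⁻¹ • (z - p) - c = θ⁻¹ • (z - (p + θ • (c - p))) := by
      have h2 : θ⁻¹ • θ • (c - p) = c - p := by
        rw [smul_smul, inv_mul_cancel₀ hθpos.ne', one_smul]
      rw [← sub_sub z p, smul_sub θ⁻¹ (z - p), h2]
      abel
    rw [h1, norm_smul, norm_inv, Real.norm_of_nonneg hθpos.le, inv_mul_le_iff₀ hθpos]
    exact hz
  set w := p + θ⁻¹ • (z - p) with hwdef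
  have hzw : z = p + θ • (w - p) := by
    rw [hwdef, add_sub_cancel_left, smul_smul, mul_inv_cancel₀ hθpos.ne', one_smul]; abel
  refine ⟨?_, ?_⟩
  · rw [hzw]
    exact hK.add_smul_sub_mem hp hw ⟨hθpos.le, hθ1⟩
  · calc inner ℝ (p - z) u ≤ ‖p - z‖ * ‖u‖ := real_inner_le_norm _ _
      _ = θ * ‖w - p‖ := by
        rw [hu, mul_one, hzw, sub_add_cancel_left, norm_neg, norm_smul,
          Real.norm_of_nonneg hθpos.le]
      _ ≤ θ * (2 * D) := by
        gcongr
        linarith [norm_sub_le w p, hKD w hw, hKD p hp]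
      _ ≤ h := hθ2

/-- A linear functional attains its maximum over a compact set on the boundary. -/
theorem exists_mem_frontier_max {E : Type*} [NormedAddCommGroup E] [InnerProductSpace ℝ E]
    {K : Set E} (hc : IsCompact K) (hne : K.Nonempty) {u : E} (hu : ‖u‖ = 1) :
    ∃ p ∈ frontier K, ∀ z ∈ K, inner ℝ z u ≤ inner ℝ p u := by
  obtain ⟨p, hp, hmax⟩ := hc.exists_isMaxOn hne
    (f := fun z => inner ℝ z u) (by fun_prop)
  refine ⟨p, ⟨subset_closure hp, fun hpi => ?_⟩, fun z hz => hmax hz⟩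
  obtain ⟨ε, hε, hball⟩ := Metric.nhds_basis_closedBall.mem_iff.mp
    (mem_interior_iff_mem_nhds.mp hpi)
  have h : p + ε • u ∈ K := hball (by
    rw [mem_closedBall_iff_norm, add_sub_cancel_left, norm_smul, hu, Real.norm_of_nonneg hε.le,
      mul_one])
  have h1 : inner ℝ (p + ε • u) u ≤ inner ℝ p u := hmax h
  rw [inner_add_left, inner_smul_left, real_inner_self_eq_norm_sq, hu] at h1
  simp only [conj_trivial] at h1
  linarith

/-- The lower bound for the product of the volumes of polar body and cap, uniformly over all caps
of small height. -/
theorem exists_height_lt_volume_mul {m : ℕ} {K : Set (EuclideanSpace ℝ (Fin (m + 1)))}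
    (hK : Convex ℝ K) (hc : IsCompact K)
    (hC2 : HasCkBoundary 2 K) (hcurv : ∀ x ∈ frontier K, 0 < gaussCurvature K x) :
    ∃ h₀ > 0, ∀ p ∈ frontier K, ∀ u : EuclideanSpace ℝ (Fin (m + 1)),
      ‖u‖ = 1 → (∀ z ∈ K, inner ℝ z u ≤ inner ℝ p u) → ∀ x ∈ K, ∀ h, 0 < h → h ≤ h₀ →
      inner ℝ (p - x) u ≤ h →
      ENNReal.ofReal (ballVolume m * ballVolume (m + 1) / (2 * (m + 2))) <
        volume (polarAt K x) * volume {z | z ∈ K ∧ inner ℝ (p - z) u ≤ h} := by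
  have hfc : IsCompact (frontier K) := hc.of_isClosed_subset isClosed_frontier
    hc.isClosed.frontier_subset
  obtain ⟨h₀, hpos, H⟩ := hfc.induction_on (p := fun s => ∃ h₀ > 0, ∀ p ∈ s, p ∈ frontier K →
      ∀ u : EuclideanSpace ℝ (Fin (m + 1)),
      ‖u‖ = 1 → (∀ z ∈ K, inner ℝ z u ≤ inner ℝ p u) → ∀ x ∈ K, ∀ h, 0 < h → h ≤ h₀ →
      inner ℝ (p - x) u ≤ h →
      ENNReal.ofReal (ballVolume m * ballVolume (m + 1) / (2 * (m + 2))) <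
        volume (polarAt K x) * volume {z | z ∈ K ∧ inner ℝ (p - z) u ≤ h})
    ⟨1, one_pos, by simp⟩
    (by
      rintro s t hst ⟨h₀, hpos, H⟩
      exact ⟨h₀, hpos, fun p hp => H p (hst hp)⟩)
    (by
      rintro s t ⟨h₁, hpos₁, H₁⟩ ⟨h₂, hpos₂, H₂⟩
      refine ⟨min h₁ h₂, lt_min hpos₁ hpos₂, ?_⟩
      rintro p (hp | hp) hpf u hu hsupp x hx h hh hle
      · exact H₁ p hp hpf u hu hsupp x hx h hh (hle.trans (min_le_left _ _))
      · exact H₂ p hp hpf u hu hsupp x hx h hh (hle.trans (min_le_right _ _)))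
    (by
      intro x hx
      obtain ⟨g, hg⟩ := hC2 x hx
      obtain ⟨V, hV, H⟩ := exists_nhds_lt_volume_mul hK hc.isClosed hg (hcurv x hx)
      exact ⟨V, mem_nhdsWithin_of_mem_nhds hV, H⟩)
  exact ⟨h₀, hpos, fun p hp => H p hp hp⟩

end Santalo

theorem proposition14 (n : ℕ) (hn : 2 ≤ n) (K : ConvexBody (EuclideanSpace ℝ (Fin n)))
    (hint : (interior (K : Set (EuclideanSpace ℝ (Fin n)))).Nonempty)
    (hC3 : Santalo.HasCkBoundary 3 (K : Set (EuclideanSpace ℝ (Fin n))))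
    (hcurv : ∀ x ∈ frontier (K : Set (EuclideanSpace ℝ (Fin n))),
      0 < Santalo.gaussCurvature (K : Set (EuclideanSpace ℝ (Fin n))) x) :
    ∃ δ₀ : ℝ, 0 < δ₀ ∧ ∀ δ : ℝ, 0 < δ → δ < δ₀ →
      Santalo.santaloRegion (K : Set (EuclideanSpace ℝ (Fin n)))
          (Santalo.ballVolume (n - 1) / (2 * ((n : ℝ) + 1) * Santalo.ballVolume n * δ)) ⊆
        Santalo.floatingBody (K : Set (EuclideanSpace ℝ (Fin n)))
          (δ * MeasureTheory.volume.real (K : Set (EuclideanSpace ℝ (Fin n)))) := by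
  obtain ⟨m, rfl⟩ : ∃ m, n = m + 1 := ⟨n - 1, by omega⟩
  have hK : Convex ℝ (K : Set (EuclideanSpace ℝ (Fin (m + 1)))) := K.convex
  have hc : IsCompact (K : Set (EuclideanSpace ℝ (Fin (m + 1)))) := K.isCompact
  have hC2 : Santalo.HasCkBoundary 2 (K : Set (EuclideanSpace ℝ (Fin (m + 1)))) := by
    intro x hx
    obtain ⟨g, hg⟩ := hC3 x hx
    exact ⟨g, hg.contDiffAt.of_le (by norm_num), hg.eq_zero, hg.gradient_ne_zero, hg.mem_iff⟩
  generalize (K : Set (EuclideanSpace ℝ (Fin (m + 1)))) = K at *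
  obtain ⟨h₀, hh₀, H⟩ := Santalo.exists_height_lt_volume_mul hK hc hC2 hcurv
  obtain ⟨s, hs, Hs⟩ := Santalo.exists_le_volume_cap hK hc hint hh₀
  have hKfin : volume K ≠ ⊤ := hc.measure_lt_top.ne
  have hKpos : 0 < volume.real K := by
    rw [Measure.real, ENNReal.toReal_pos_iff]
    exact ⟨Measure.measure_pos_of_nonempty_interior _ hint, hc.measure_lt_top⟩
  -- Here `s` bounds below the volumes of all caps of height `h₀`, so a cap of volume `δ|K| < s` has
  -- height below `h₀`.
  refine ⟨s / volume.real K, by positivity, fun δ hδ hδs x hx => ?_⟩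
  rw [lt_div_iff₀ hKpos] at hδs
  obtain ⟨hxK, hxS⟩ := hx
  refine ⟨hxK, fun u a hu hvol => ?_⟩
  by_contra! hax
  obtain ⟨p, hpf, hpmax⟩ := Santalo.exists_mem_frontier_max hc ⟨x, hxK⟩ hu
  have hcap : {z | z ∈ K ∧ inner ℝ (p - z) u ≤ inner ℝ p u - a} =
      {y | y ∈ K ∧ a ≤ inner ℝ y u} := by
    ext z
    simp only [Set.mem_ofPred_eq, inner_sub_left, sub_le_sub_iff_left]
  have hxp := hpmax x hxK
  have hle : inner ℝ p u - a ≤ h₀ := by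
    by_contra! hlt
    have h1 := Hs p (hc.isClosed.frontier_subset hpf) u hu
    have h2 : {z | z ∈ K ∧ inner ℝ (p - z) u ≤ h₀} ⊆
        {z | z ∈ K ∧ inner ℝ (p - z) u ≤ inner ℝ p u - a} :=
      fun z hz => ⟨hz.1, hz.2.trans hlt.le⟩
    have h3 := (measure_mono (μ := volume) h2).trans_eq (hcap ▸ hvol)
    exact absurd (h1.trans h3) (not_le.mpr ((ENNReal.ofReal_lt_ofReal_iff hs).mpr hδs))
  have key := H p hpf u hu hpmax x hxK (inner ℝ p u - a) (by linarith) hle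
    (by rw [inner_sub_left]; linarith)
  rw [hcap, hvol] at key
  have v1 := Santalo.ballVolume_pos m
  have v2 := Santalo.ballVolume_pos (m + 1)
  -- Multiplied by `δ`, the Santaló condition bounds the same product above by the constant in
  -- `key`, as `n + 1 = m + 2`.
  rw [ENNReal.div_le_iff (by simpa using v2.ne') ENNReal.ofReal_ne_top,
    ← ENNReal.ofReal_mul (by positivity), Nat.add_sub_cancel] at hxS
  refine absurd key (not_lt.mpr ?_)
  calc volume (Santalo.polarAt K x) * ENNReal.ofReal (δ * volume.real K)
      = ENNReal.ofReal δ * (volume K * volume (Santalo.polarAt K x)) := by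
        rw [ENNReal.ofReal_mul hδ.le, ofReal_measureReal hKfin]; ring
    _ ≤ ENNReal.ofReal δ * ENNReal.ofReal (Santalo.ballVolume m /
          (2 * (((m + 1 : ℕ) : ℝ) + 1) * Santalo.ballVolume (m + 1) * δ) *
          Santalo.ballVolume (m + 1) ^ 2) := by gcongr
    _ = _ := by
        rw [← ENNReal.ofReal_mul hδ.le]
        congr 1
        push_cast
        field_simp
        ring
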